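/- Let $\mathbb{D}=\{z\in\mathbb{C}:|z|<1\}$ and identify $\mathbb{C}$ with $\mathbb{R}^2$. Let $W:\overline{\mathbb{D}}\to\mathbb{C}$ be a vector field of class $\mathscr{C}^1$ on $\overline{\mathbb{D}}$ (up to the boundary) such that i) $W$ is divergence-free: $\partial_x\operatorname{Re}W+\partial_y\operatorname{Im}W=0$ in $\mathbb{D}$; ii) $W$ is tangent to the unit circle: $\operatorname{Re}\big(W(z)\overline{z}\big)=0$ whenever $|z|=1$; iii) for $z\in\overline{\mathbb{D}}$, $W(z)=0$ if and only if $z=0$. Then for every $z\in\overline{\mathbb{D}}$ the Cauchy problem $\partial_t\psi(t,z)=W(\psi(t,z))$, $\psi(0,z)=z$ has a solution $t\mapsto\psi(t,z)\in\overline{\mathbb{D}}$ defined for all $t\in\mathbb{R}$, and every solution in $\overline{\mathbb{D}}$ with the same initial value on any interval containing $0$ is a restriction of it. Moreover: 1. All trajectories are periodic orbits located inside the unit disc, enclosing a simply connected domain containing the origin. That is: the origin is an equilibrium, $\psi(t,0)=0$ for all $t$; if $|z|<1$ then $|\psi(t,z)|<1$ for all $t$; and for every $z\in\overline{\mathbb{D}}\setminus\{0\}$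 there is $T>0$ such that $t\mapsto\psi(t,z)$ is $T$-periodic and injective on $[0,T)$, and there is a bounded simply connected open set $\Omega\ni 0$ whose boundary is exactly the orbit $\{\psi(t,z):t\in\mathbb{R}\}$. 2. The family $(\psi(t,\cdot))_{t\in\mathbb{R}}$ is a group of diffeomorphisms of the closed unit disc: each $\psi(t,\cdot)$ is a bijection of $\overline{\mathbb{D}}$ which, together with its inverse, is $\mathscr{C}^1$ up to the boundary, and $\psi(s+t,z)=\psi(s,\psi(t,z))$ for all $s,t\in\mathbb{R}$ and $z\in\overline{\mathbb{D}}$. 3. If $\overline{W(z)}=-W(\overline{z})$ for all $z\in\overline{\mathbb{D}}$, then every orbit is symmetric with respect to the real axis, i.e. it is mapped onto itself by $w\mapsto\overline{w}$. 4. If $\theta_0\in\mathbb{R}$ and $W(e^{i\theta_0}z)=e^{i\theta_0}W(z)$ for all $z\in\overline{\mathbb{D}}$, then every orbit is mapped onto itself by the rotation $w\mapsto e^{i\theta_0}w$. -/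

import Mathlib

/-- The closed unit disc of the complex plane. -/
def closedDisc : Set ℂ := Metric.closedBall (0 : ℂ) 1

/-- The open unit disc of the complex plane. -/
def openDisc : Set ℂ := Metric.ball (0 : ℂ) 1

/-- The divergence `∂ₓ (Re W) + ∂_y (Im W)` of a planar vector field, with `ℂ = ℝ²`. -/
noncomputable def planarDiv (W : ℂ → ℂ) (z : ℂ) : ℝ :=
  (fderiv ℝ W z 1).re + (fderiv ℝ W z Complex.I).im

/-- `W` is a `C¹` divergence-free vector field on the closed unit disc, tangent to the unit
circle, whose only zero is the origin. Only the values of `W` on the closed disc matter. -/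
structure IsAdmissibleField (W : ℂ → ℂ) : Prop where
  contDiffOn : ContDiffOn ℝ 1 W closedDisc
  div_eq_zero : ∀ z ∈ openDisc, planarDiv W z = 0
  tangent : ∀ z : ℂ, ‖z‖ = 1 → (W z * (starRingEnd ℂ) z).re = 0
  zero_iff : ∀ z ∈ closedDisc, W z = 0 ↔ z = 0

/-- `ψ` is a global flow of `W` on the closed disc: for every `z` in the closed disc,
`t ↦ ψ t z` is defined for all times, stays in the closed disc and solves
`∂ₜ ψ(t,z) = W(ψ(t,z))`, `ψ(0,z) = z`. -/
structure IsDiscFlow (W : ℂ → ℂ) (ψ : ℝ → ℂ → ℂ) : Prop where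
  init : ∀ z ∈ closedDisc, ψ 0 z = z
  mem : ∀ t : ℝ, ∀ z ∈ closedDisc, ψ t z ∈ closedDisc
  deriv : ∀ t : ℝ, ∀ z ∈ closedDisc, HasDerivAt (fun s => ψ s z) (W (ψ t z)) t

/-- `γ` is a trajectory of `W` in the closed disc on the time set `S`. -/
def IsDiscTrajectoryOn (W : ℂ → ℂ) (γ : ℝ → ℂ) (S : Set ℝ) : Prop :=
  Set.MapsTo γ S closedDisc ∧ IsIntegralCurveOn γ (fun _ => W) S

/-- The orbit of `z`. -/
def flowOrbit (ψ : ℝ → ℂ → ℂ) (z : ℂ) : Set ℂ := Set.range (fun t => ψ t z)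

/-- `Ω` is a bounded simply connected domain whose boundary is exactly `Γ`. When `Γ` is a Jordan
curve, this says that `Ω` is the bounded component of the complement of `Γ`, and that it is
simply connected. -/
structure IsSimplyConnectedDomainEnclosedBy (Ω Γ : Set ℂ) : Prop where
  isOpen : IsOpen Ω
  isBounded : Bornology.IsBounded Ω
  simplyConnected : IsSimplyConnected Ω
  frontier_eq : frontier Ω = Γ

/-- `g` restricts to a `C¹` diffeomorphism of the closed unit disc onto itself (smoothness being
up to the boundary). -/
def IsClosedDiscDiffeo (g : ℂ → ℂ) : Prop :=
  Set.BijOn g closedDisc closedDisc ∧ ContDiffOn ℝ 1 g closedDisc ∧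
    ∃ h : ℂ → ℂ, Set.MapsTo h closedDisc closedDisc ∧ Set.InvOn h g closedDisc closedDisc ∧
      ContDiffOn ℝ 1 h closedDisc

/-! Vanishing divergence means that the 1-form `det(W, ·)` is closed, hence exact on the convex
closed disc. Its primitive `H` is constant along trajectories and, by tangency, on the unit circle.
Critical points of `H` inside the disc are zeros of `W`, so the origin is the only possible interior
extremum. After a choice of sign and of additive constant, `H` vanishes on the circle, is positive
inside and has a strict maximum at `0` (`exists_isStreamFunction`).

Orbits lie in level sets of `H`; the core is that each level set `H = c`, `0 ≤ c < H 0`, is a single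
orbit (`flowOrbit_eq_levelSet`). Rotating `W` by a right angle and dividing by `|W|²` gives an
ascent field along which `H` grows at unit speed, so its flow at time `c` carries the unit circle
onto the level set. The level set is therefore the image of a closed `C¹` curve whose velocity is
parallel to the nonvanishing field `W`; by uniqueness for ODEs the curve is a time change of one
trajectory. One turn takes bounded time, so a single trajectory covers the level set in bounded
time. This gives transitivity and also periodicity, without Poincaré–Bendixson or Jordan arguments.

The enclosed domain is the superlevel set `H > c`: its frontier is the level set, and the ascent
flow contracts it to the origin. The two symmetries preserve `dH`, hence `H`, hence every orbit.

Boundary difficulties are avoided by composing fields with the radial retraction: the extended field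
is bounded and Lipschitz on the plane, and the disc is forward invariant if the field points inward.
Smoothness up to the boundary comes from the variational equation on a compact convex set. -/

/-! ### Global flows of bounded Lipschitz fields -/

section GlobalFlow

variable {E : Type*} [NormedAddCommGroup E] [NormedSpace ℝ E]

/-- A bounded Lipschitz vector field has a solution on each interval `[-T, T]`. -/
theorem exists_solution_Icc_of_bounded_lipschitz [CompleteSpace E] {X : E → E} {K C : NNReal}
    (hX : LipschitzWith K X) (hC : ∀ x, ‖X x‖ ≤ C) (x : E) (T : NNReal) :
    ∃ α : ℝ → E, α 0 = x ∧
      ∀ t ∈ Set.Icc (-T : ℝ) T, HasDerivWithinAt α (X (α t)) (Set.Icc (-T : ℝ) T) t := by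
  have hT : (0 : ℝ) ∈ Set.Icc (-T : ℝ) T := ⟨by simp, T.2⟩
  -- Speed at most `C` during time `T` stays within radius `C * T`, so the Picard–Lindelöf condition
  -- places no restriction on `T`.
  have hf : IsPicardLindelof (fun _ => X) (⟨0, hT⟩ : Set.Icc (-T : ℝ) T) x (C * T) 0 C K :=
    { lipschitzOnWith := fun _ _ => hX.lipschitzOnWith
      continuousOn := fun _ _ => continuousOn_const
      norm_le := fun _ _ y _ => hC y
      mul_max_le := by simp }
  exact hf.exists_eq_forall_mem_Icc_hasDerivWithinAt₀

/-- A bounded Lipschitz vector field has a globally defined integral curve through each point. -/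
theorem exists_integralCurve_of_bounded_lipschitz [CompleteSpace E] {X : E → E} {K C : NNReal}
    (hX : LipschitzWith K X) (hC : ∀ x, ‖X x‖ ≤ C) (x : E) :
    ∃ α : ℝ → E, α 0 = x ∧ ∀ t, HasDerivAt α (X (α t)) t := by
  choose β hβ0 hβ using fun n : ℕ =>
    exists_solution_Icc_of_bounded_lipschitz hX hC x (n + 1 : NNReal)
  have hβ' : ∀ n : ℕ, ∀ t ∈ Set.Ioo (-(n + 1) : ℝ) (n + 1), HasDerivAt (β n) (X (β n t)) t := by
    intro n t ht
    have := hβ n t (by push_cast; exact Set.Ioo_subset_Icc_self ht)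
    push_cast at this
    exact this.hasDerivAt (Icc_mem_nhds ht.1 ht.2)
  have key : ∀ m n : ℕ, m ≤ n → Set.EqOn (β m) (β n) (Set.Ioo (-(m + 1) : ℝ) (m + 1)) := by
    intro m n hmn
    have hmn' : (m : ℝ) ≤ n := by exact_mod_cast hmn
    have hm : (0 : ℝ) ≤ m := Nat.cast_nonneg m
    refine ODE_solution_unique_of_mem_Ioo (v := fun _ => X) (s := fun _ => Set.univ) (K := K)
      (t₀ := 0) (fun _ _ => hX.lipschitzOnWith) ⟨by linarith, by linarith⟩
      (fun t ht => ⟨hβ' m t ht, trivial⟩)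
      (fun t ht => ⟨hβ' n t ⟨by linarith [ht.1], by linarith [ht.2]⟩, trivial⟩) ?_
    rw [hβ0, hβ0]
  -- The `n`-th solution lives on `[-(n + 1), n + 1]`, so `t` is interior to the interval of index
  -- `⌈|t|⌉₊`.
  refine ⟨fun t => β ⌈|t|⌉₊ t, by simp [hβ0], fun t => ?_⟩
  set N := ⌈|t|⌉₊ with hN
  have htN : |t| ≤ N := Nat.le_ceil _
  have ht : t ∈ Set.Ioo (-(N + 1) : ℝ) (N + 1) := by
    constructor <;> linarith [abs_le.1 htN]
  refine (hβ' N t ht).congr_of_eventuallyEq ?_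
  filter_upwards [isOpen_Ioo.mem_nhds ht] with s hs
  have hsm : |s| ≤ ⌈|s|⌉₊ := Nat.le_ceil _
  rcases le_total ⌈|s|⌉₊ N with h | h
  · exact key _ _ h ⟨by linarith [(abs_le.1 hsm).1], by linarith [(abs_le.1 hsm).2]⟩
  · exact (key _ _ h hs).symm

/-- `Φ` is the global flow of the vector field `X`. -/
structure IsGlobalFlow (X : E → E) (Φ : ℝ → E → E) : Prop where
  init : ∀ x, Φ 0 x = x
  deriv : ∀ t x, HasDerivAt (fun s => Φ s x) (X (Φ t x)) t

theorem exists_isGlobalFlow [CompleteSpace E] {X : E → E} {K C : NNReal}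
    (hX : LipschitzWith K X) (hC : ∀ x, ‖X x‖ ≤ C) : ∃ Φ, IsGlobalFlow X Φ := by
  choose α h0 h1 using exists_integralCurve_of_bounded_lipschitz hX hC
  exact ⟨fun t x => α x t, h0, fun t x => h1 x t⟩

theorem IsGlobalFlow.eq_of_hasDerivAt {X : E → E} {Φ : ℝ → E → E} {K : NNReal}
    (hΦ : IsGlobalFlow X Φ) (hX : LipschitzWith K X) {γ : ℝ → E}
    (hγ : ∀ t, HasDerivAt γ (X (γ t)) t) (t : ℝ) : γ t = Φ t (γ 0) := by
  refine congrFun (ODE_solution_unique_univ (v := fun _ => X) (s := fun _ => Set.univ) (K := K)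
    (t₀ := 0) (f := γ) (g := fun s => Φ s (γ 0)) (fun _ => hX.lipschitzOnWith)
    (fun s => ⟨hγ s, trivial⟩) (fun s => ⟨hΦ.deriv s _, trivial⟩) (hΦ.init _).symm) t

theorem IsGlobalFlow.map_add {X : E → E} {Φ : ℝ → E → E} {K : NNReal}
    (hΦ : IsGlobalFlow X Φ) (hX : LipschitzWith K X) (s t : ℝ) (x : E) :
    Φ (s + t) x = Φ s (Φ t x) := by
  have := hΦ.eq_of_hasDerivAt hX (γ := fun r => Φ (r + t) x)
    (fun r => (hΦ.deriv (r + t) x).comp_add_const r t) s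
  simpa using this

theorem IsGlobalFlow.neg {X : E → E} {Φ : ℝ → E → E} (hΦ : IsGlobalFlow X Φ) :
    IsGlobalFlow (fun x => -X x) (fun t x => Φ (-t) x) where
  init x := by simp [hΦ.init]
  deriv t x := by
    have := (hΦ.deriv (-t) x).scomp t (hasDerivAt_neg t)
    simpa [Function.comp_def] using this

theorem IsGlobalFlow.dist_le {X : E → E} {Φ : ℝ → E → E} {K : NNReal}
    (hΦ : IsGlobalFlow X Φ) (hX : LipschitzWith K X) {t : ℝ} (ht : 0 ≤ t) (x y : E) :
    dist (Φ t x) (Φ t y) ≤ dist x y * Real.exp (K * t) := by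
  have := dist_le_of_trajectories_ODE (v := fun _ => X) (K := K) (a := 0) (b := t)
    (f := fun s => Φ s x) (g := fun s => Φ s y) (δ := dist x y) (fun _ => hX)
    (fun s _ => (hΦ.deriv s x).continuousAt.continuousWithinAt)
    (fun s _ => (hΦ.deriv s x).hasDerivWithinAt)
    (fun s _ => (hΦ.deriv s y).continuousAt.continuousWithinAt)
    (fun s _ => (hΦ.deriv s y).hasDerivWithinAt) (by simp [hΦ.init]) t ⟨ht, le_rfl⟩
  simpa using this

/-- Grönwall gives a Lipschitz bound in `x` that is locally uniform in `t`; with continuity in `t`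
this yields joint continuity, needed later for a homotopy. -/
theorem IsGlobalFlow.continuous_uncurry {X : E → E} {Φ : ℝ → E → E} {K : NNReal}
    (hΦ : IsGlobalFlow X Φ) (hX : LipschitzWith K X) :
    Continuous (fun p : ℝ × E => Φ p.1 p.2) := by
  have hneg : LipschitzWith K (fun x => -X x) := fun x y => by
    rw [edist_neg_neg]; exact hX x y
  have hd : ∀ t x y, dist (Φ t x) (Φ t y) ≤ dist x y * Real.exp (K * |t|) := by
    intro t x y
    rcases le_total 0 t with h | h
    · rw [abs_of_nonneg h]; exact hΦ.dist_le hX h x y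
    · rw [abs_of_nonpos h]
      simpa using hΦ.neg.dist_le hneg (t := -t) (by linarith) x y
  rw [continuous_iff_continuousAt]
  rintro ⟨t, x⟩
  have h1 : Filter.Tendsto (fun p : ℝ × E => dist p.2 x * Real.exp (K * |p.1|) +
      dist (Φ p.1 x) (Φ t x)) (nhds (t, x)) (nhds 0) := by
    have hc : ContinuousAt (fun p : ℝ × E => dist p.2 x * Real.exp (K * |p.1|) +
        dist (Φ p.1 x) (Φ t x)) (t, x) := by
      have h2 : ContinuousAt (fun p : ℝ × E => Φ p.1 x) (t, x) :=
        ContinuousAt.comp (f := fun p : ℝ × E => p.1) (g := fun s => Φ s x)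
          (hΦ.deriv t x).continuousAt continuousAt_fst
      have h3 : ContinuousAt (fun p : ℝ × E => dist p.2 x * Real.exp (K * |p.1|)) (t, x) := by
        fun_prop
      exact h3.add (h2.dist continuousAt_const)
    simpa [ContinuousAt] using hc
  refine tendsto_iff_dist_tendsto_zero.2 (squeeze_zero (fun _ => dist_nonneg) (fun p => ?_) h1)
  calc dist (Φ p.1 p.2) (Φ t x) ≤ dist (Φ p.1 p.2) (Φ p.1 x) + dist (Φ p.1 x) (Φ t x) :=
        dist_triangle _ _ _
    _ ≤ _ := by gcongr; exact hd _ _ _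

end GlobalFlow

/-! ### Differentiable dependence on initial conditions up to the boundary -/

section SmoothDependence

variable {E : Type*} [NormedAddCommGroup E] [NormedSpace ℝ E]

theorem gronwallBound_zero_eq_mul (K ε x : ℝ) :
    gronwallBound 0 K ε x = ε * gronwallBound 0 K 1 x := by
  unfold gronwallBound
  split_ifs <;> ring

/-- A `C¹` vector field on a compact convex set is uniformly differentiable. -/
theorem exists_uniform_differentiability {X : E → E} {X' : E → E →L[ℝ] E} {K : Set E}
    (hK : IsCompact K) (hKc : Convex ℝ K) (hX : ∀ x ∈ K, HasFDerivWithinAt X (X' x) K x)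
    (hX' : ContinuousOn X' K) {ε : ℝ} (hε : 0 < ε) :
    ∃ δ > 0, ∀ a ∈ K, ∀ b ∈ K, dist b a < δ →
      ‖X' b - X' a‖ ≤ ε ∧ ‖X b - X a - X' a (b - a)‖ ≤ ε * ‖b - a‖ := by
  have huc := hK.uniformContinuousOn_of_continuous hX'
  obtain ⟨δ, hδ, h⟩ := Metric.uniformContinuousOn_iff.1 huc ε hε
  have h' : ∀ a ∈ K, ∀ b ∈ K, dist b a < δ → ‖X' b - X' a‖ ≤ ε := fun a ha b hb hab => by
    rw [← dist_eq_norm]; exact (h b hb a ha hab).le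
  refine ⟨δ, hδ, fun a ha b hb hab => ⟨h' a ha b hb hab, ?_⟩⟩
  refine Convex.norm_image_sub_le_of_norm_hasFDerivWithin_le' (s := K ∩ Metric.ball a δ)
    (f' := X') (fun x hx => (hX x hx.1).mono Set.inter_subset_left)
    (fun x hx => h' a ha x hx.1 hx.2) (hKc.inter (convex_ball a δ))
    ⟨ha, Metric.mem_ball_self hδ⟩ ⟨hb, hab⟩

/-- Solution of the variational equation for a short time. -/
theorem exists_variational_solution [CompleteSpace E] {A : ℝ → E →L[ℝ] E} {M : NNReal} {τ : ℝ}
    (hτ : 0 ≤ τ) (hMτ : 2 * M * τ ≤ 1) (hA : ContinuousOn A (Set.Icc 0 τ))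
    (hAM : ∀ t ∈ Set.Icc 0 τ, ‖A t‖ ≤ M) :
    ∃ J : ℝ → E →L[ℝ] E, J 0 = 1 ∧
      (∀ t ∈ Set.Icc 0 τ, HasDerivWithinAt J (A t * J t) (Set.Icc 0 τ) t) ∧
      ∀ t ∈ Set.Icc 0 τ, ‖J t‖ ≤ Real.exp (M * τ) := by
  have h1 : ‖(1 : E →L[ℝ] E)‖ ≤ 1 := ContinuousLinearMap.norm_id_le
  -- In the unit ball around the identity `‖J‖ ≤ 2`, so the speed is at most `2 * M`, and `2 * M * τ
  -- ≤ 1` keeps the solution in that ball.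
  have hf : IsPicardLindelof (fun t (J : E →L[ℝ] E) => A t * J)
      (⟨0, le_rfl, hτ⟩ : Set.Icc (0 : ℝ) τ) 1 1 0 (2 * M) M :=
    { lipschitzOnWith := fun t ht => by
        refine LipschitzOnWith.of_dist_le_mul fun x _ y _ => ?_
        rw [dist_eq_norm, dist_eq_norm, ← mul_sub]
        exact (norm_mul_le _ _).trans (by gcongr; exact hAM t ht)
      continuousOn := fun x _ => hA.mul continuousOn_const
      norm_le := fun t ht x hx => by
        have hx2 : ‖x‖ ≤ 2 := by
          have h2 : ‖x - 1‖ ≤ 1 := by simpa [dist_eq_norm] using hx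
          calc ‖x‖ = ‖(x - 1) + 1‖ := by simp
            _ ≤ ‖x - 1‖ + ‖(1 : E →L[ℝ] E)‖ := norm_add_le _ _
            _ ≤ 2 := by linarith
        calc ‖A t * x‖ ≤ ‖A t‖ * ‖x‖ := norm_mul_le _ _
          _ ≤ M * 2 := by gcongr; exact hAM t ht
          _ = _ := by push_cast; ring
      mul_max_le := by simp [hτ]; linarith }
  obtain ⟨J, hJ0, hJ⟩ := hf.exists_eq_forall_mem_Icc_hasDerivWithinAt₀
  refine ⟨J, hJ0, hJ, fun t ht => ?_⟩
  have := norm_le_gronwallBound_of_norm_deriv_right_le (f := J) (f' := fun t => A t * J t)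
    (δ := 1) (K := M) (ε := 0) (a := 0) (b := τ)
    (fun t ht => (hJ t ht).continuousWithinAt)
    (fun t ht => (hJ t ⟨ht.1, ht.2.le⟩).mono_of_mem_nhdsWithin (Icc_mem_nhdsGE_of_mem ht))
    (by rw [show J 0 = 1 from hJ0]; exact h1)
    (fun t ht => by
      rw [add_zero]
      exact (norm_mul_le _ _).trans (by gcongr; exact hAM t ⟨ht.1, ht.2.le⟩)) t ht
  rw [gronwallBound_ε0, one_mul, sub_zero] at this
  exact this.trans (by gcongr; exact ht.2)

/-- Differentiable dependence on the initial condition, up to the boundary of a compact convex set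
of initial conditions, for a short time. -/
theorem contDiffOn_flow_of_small_time [CompleteSpace E] {X : E → E} {X' : E → E →L[ℝ] E}
    {K : Set E} {M : NNReal} {τ : ℝ} {φ : ℝ → E → E}
    (hK : IsCompact K) (hKc : Convex ℝ K) (hX : ∀ x ∈ K, HasFDerivWithinAt X (X' x) K x)
    (hX' : ContinuousOn X' K) (hM : ∀ x ∈ K, ‖X' x‖ ≤ M)
    (hτ : 0 ≤ τ) (hMτ : 2 * M * τ ≤ 1)
    (h0 : ∀ x ∈ K, φ 0 x = x) (hmem : ∀ t ∈ Set.Icc 0 τ, ∀ x ∈ K, φ t x ∈ K)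
    (hφ : ∀ t ∈ Set.Icc 0 τ, ∀ x ∈ K, HasDerivAt (fun s => φ s x) (X (φ t x)) t) :
    ContDiffOn ℝ 1 (φ τ) K := by
  have hXL : LipschitzOnWith M X K :=
    hKc.lipschitzOnWith_of_nnnorm_hasFDerivWithin_le hX fun x hx => hM x hx
  set C : ℝ := Real.exp (M * τ) with hC
  have hC0 : 0 < C := Real.exp_pos _
  have hφc : ∀ x ∈ K, ContinuousOn (fun s => φ s x) (Set.Icc 0 τ) := fun x hx t ht =>
    (hφ t ht x hx).continuousAt.continuousWithinAt
  have hlip : ∀ x ∈ K, ∀ y ∈ K, ∀ t ∈ Set.Icc 0 τ, dist (φ t y) (φ t x) ≤ C * dist y x := by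
    intro x hx y hy t ht
    have := dist_le_of_trajectories_ODE_of_mem (v := fun _ => X) (K := M) (s := fun _ => K)
      (a := 0) (b := τ) (f := fun s => φ s y) (g := fun s => φ s x) (δ := dist y x)
      (fun _ _ => hXL) (hφc y hy) (fun s hs => (hφ s ⟨hs.1, hs.2.le⟩ y hy).hasDerivWithinAt)
      (fun s hs => hmem s ⟨hs.1, hs.2.le⟩ y hy)
      (hφc x hx) (fun s hs => (hφ s ⟨hs.1, hs.2.le⟩ x hx).hasDerivWithinAt)
      (fun s hs => hmem s ⟨hs.1, hs.2.le⟩ x hx) (by simp [h0 x hx, h0 y hy]) t ht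
    rw [sub_zero] at this
    refine this.trans ?_
    rw [mul_comm, hC]
    gcongr
    exact ht.2
  have hJex : ∀ x : E, ∃ J : ℝ → E →L[ℝ] E, x ∈ K → J 0 = 1 ∧
      (∀ t ∈ Set.Icc 0 τ, HasDerivWithinAt J (X' (φ t x) * J t) (Set.Icc 0 τ) t) ∧
      ∀ t ∈ Set.Icc 0 τ, ‖J t‖ ≤ C := by
    intro x
    by_cases hx : x ∈ K
    · obtain ⟨J, hJ⟩ := exists_variational_solution (A := fun t => X' (φ t x)) hτ hMτ
        (hX'.comp (hφc x hx) fun t ht => hmem t ht x hx) (fun t ht => hM _ (hmem t ht x hx))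
      exact ⟨J, fun _ => hJ⟩
    · exact ⟨0, fun h => absurd h hx⟩
  choose J hJ using hJex
  have hJd : ∀ x ∈ K, ∀ t ∈ Set.Ico 0 τ,
      HasDerivWithinAt (J x) (X' (φ t x) * J x t) (Set.Ici t) t := fun x hx t ht =>
    ((hJ x hx).2.1 t ⟨ht.1, ht.2.le⟩).mono_of_mem_nhdsWithin (Icc_mem_nhdsGE_of_mem ht)
  have hJc : ∀ x ∈ K, ContinuousOn (J x) (Set.Icc 0 τ) := fun x hx t ht =>
    ((hJ x hx).2.1 t ht).continuousWithinAt
  set B : ℝ := gronwallBound 0 M 1 τ with hB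
  have hB0 : 0 ≤ B := by
    have := gronwallBound_mono (δ := 0) (ε := 1) (K := M) le_rfl zero_le_one M.2 hτ
    simpa [gronwallBound_x0] using this
  have hττ : τ ∈ Set.Icc 0 τ := ⟨hτ, le_rfl⟩
  have hsmall : ∀ ε > 0, ∃ δ > 0, ∀ x ∈ K, ∀ y ∈ K, dist y x < δ →
      ‖φ τ y - φ τ x - J x τ (y - x)‖ ≤ ε * ‖y - x‖ ∧ ‖J y τ - J x τ‖ ≤ ε := by
    intro ε hε
    -- Both Grönwall estimates below end with a factor `η * C * B`. The denominator has `B + 1`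
    -- because `B` vanishes when `τ = 0`.
    have hε' : 0 < ε / (C * (B + 1)) := by positivity
    set η := ε / (C * (B + 1)) with hη
    have hηε : η * C * B ≤ ε := by
      rw [hη, div_mul_eq_mul_div, div_mul_eq_mul_div, div_le_iff₀ (by positivity)]
      nlinarith [mul_pos hε hC0]
    obtain ⟨δ, hδ, h⟩ := exists_uniform_differentiability hK hKc hX hX' hε'
    refine ⟨δ / C, by positivity, fun x hx y hy hxy => ?_⟩
    have hnear : ∀ t ∈ Set.Icc 0 τ, dist (φ t y) (φ t x) < δ := fun t ht =>
      (hlip x hx y hy t ht).trans_lt (by rwa [lt_div_iff₀' hC0] at hxy)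
    constructor
    -- The remainder of the first-order expansion solves the linearised equation along `φ t x`, up
    -- to the Taylor error of `X`, which is at most `η * (C * ‖y - x‖)`.
    · have := norm_le_gronwallBound_of_norm_deriv_right_le
        (f := fun t => φ t y - φ t x - J x t (y - x))
        (f' := fun t => X (φ t y) - X (φ t x) - (X' (φ t x) * J x t) (y - x))
        (δ := 0) (K := M) (ε := η * (C * ‖y - x‖)) (a := 0) (b := τ)
        (((hφc y hy).sub (hφc x hx)).sub ((hJc x hx).clm_apply continuousOn_const))
        (fun t ht => by
          have h1 := (hφ t ⟨ht.1, ht.2.le⟩ y hy).hasDerivWithinAt (s := Set.Ici t)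
          have h2 := (hφ t ⟨ht.1, ht.2.le⟩ x hx).hasDerivWithinAt (s := Set.Ici t)
          have h3 := (hJd x hx t ht).clm_apply (hasDerivWithinAt_const t (Set.Ici t) (y - x))
          exact ((h1.fun_sub h2).fun_sub h3).congr_deriv (by simp))
        (by simp [h0 x hx, h0 y hy, (hJ x hx).1])
        (fun t ht => by
          have ht' : t ∈ Set.Icc 0 τ := ⟨ht.1, ht.2.le⟩
          have h1 := (h _ (hmem t ht' x hx) _ (hmem t ht' y hy) (hnear t ht')).2
          have h2 : X (φ t y) - X (φ t x) - (X' (φ t x) * J x t) (y - x) =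
              X' (φ t x) (φ t y - φ t x - J x t (y - x)) +
              (X (φ t y) - X (φ t x) - X' (φ t x) (φ t y - φ t x)) := by
            simp only [map_sub, mul_apply_eq_comp]
            abel
          rw [h2]
          refine (norm_add_le _ _).trans (add_le_add ?_ (h1.trans ?_))
          · exact ((X' (φ t x)).le_opNorm _).trans (by gcongr; exact hM _ (hmem t ht' x hx))
          · have := hlip x hx y hy t ht'
            rw [dist_eq_norm, dist_eq_norm] at this
            gcongr) τ hττ
      rw [gronwallBound_zero_eq_mul, sub_zero] at this
      refine this.trans ?_
      calc η * (C * ‖y - x‖) * B = (η * C * B) * ‖y - x‖ := by ring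
        _ ≤ ε * ‖y - x‖ := by gcongr
    · have := norm_le_gronwallBound_of_norm_deriv_right_le
        (f := fun t => J y t - J x t)
        (f' := fun t => X' (φ t y) * J y t - X' (φ t x) * J x t)
        (δ := 0) (K := M) (ε := η * C) (a := 0) (b := τ)
        ((hJc y hy).sub (hJc x hx))
        (fun t ht => (hJd y hy t ht).sub (hJd x hx t ht))
        (by simp [(hJ x hx).1, (hJ y hy).1])
        (fun t ht => by
          have ht' : t ∈ Set.Icc 0 τ := ⟨ht.1, ht.2.le⟩
          have h1 := (h _ (hmem t ht' x hx) _ (hmem t ht' y hy) (hnear t ht')).1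
          have h2 : X' (φ t y) * J y t - X' (φ t x) * J x t =
              X' (φ t x) * (J y t - J x t) + (X' (φ t y) - X' (φ t x)) * J y t := by
            noncomm_ring
          rw [h2]
          refine (norm_add_le _ _).trans (add_le_add ?_ ?_)
          · exact (norm_mul_le _ _).trans (by gcongr; exact hM _ (hmem t ht' x hx))
          · exact (norm_mul_le _ _).trans
              (mul_le_mul h1 ((hJ y hy).2.2 t ht') (norm_nonneg _) hε'.le)) τ hττ
      rw [gronwallBound_zero_eq_mul, sub_zero] at this
      exact this.trans hηε
  intro x hx
  refine (contDiffOn_succ_iff_hasFDerivWithinAt (n := 0) (by simp)).2 ?_ x hx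
  intro x hx
  refine ⟨K, by rw [Set.insert_eq_of_mem hx]; exact self_mem_nhdsWithin, by simp,
    fun x => J x τ, fun x hx => ?_, contDiffOn_zero.2 ?_⟩
  · rw [hasFDerivWithinAt_iff_isLittleO, Asymptotics.isLittleO_iff]
    intro ε hε
    obtain ⟨δ, hδ, h⟩ := hsmall ε hε
    filter_upwards [self_mem_nhdsWithin, mem_nhdsWithin_of_mem_nhds (Metric.ball_mem_nhds x hδ)]
      with y hy hyx
    exact (h x hx y hy hyx).1
  · refine Metric.continuousOn_iff.2 fun x hx ε hε => ?_
    obtain ⟨δ, hδ, h⟩ := hsmall (ε / 2) (by positivity)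
    refine ⟨δ, hδ, fun y hy hyx => ?_⟩
    rw [dist_eq_norm]
    linarith [(h x hx y hy hyx).2]

/-- A forward invariant flow of a `C¹` vector field on a compact convex set is `C¹` in the initial
condition. -/
theorem contDiffOn_semiflow [CompleteSpace E] {X : E → E} {K : Set E} {φ : ℝ → E → E}
    (hK : IsCompact K) (hKc : Convex ℝ K) (hKu : UniqueDiffOn ℝ K) (hX : ContDiffOn ℝ 1 X K)
    (h0 : ∀ x ∈ K, φ 0 x = x) (hmem : ∀ t, 0 ≤ t → ∀ x ∈ K, φ t x ∈ K)
    (hφ : ∀ t, 0 ≤ t → ∀ x ∈ K, HasDerivAt (fun s => φ s x) (X (φ t x)) t)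
    (hadd : ∀ s t x, φ (s + t) x = φ s (φ t x)) {t : ℝ} (ht : 0 ≤ t) :
    ContDiffOn ℝ 1 (φ t) K := by
  have hX' := hX.continuousOn_fderivWithin hKu le_rfl
  obtain ⟨M, hM⟩ := hK.exists_bound_of_continuousOn hX'
  have hsmall : ∀ τ, 0 ≤ τ → 2 * (M.toNNReal : ℝ) * τ ≤ 1 → ContDiffOn ℝ 1 (φ τ) K :=
    fun τ hτ hMτ => contDiffOn_flow_of_small_time hK hKc
      (fun x hx => (hX.differentiableOn one_ne_zero x hx).hasFDerivWithinAt) hX'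
      (fun x hx => (hM x hx).trans (Real.le_coe_toNNReal M)) hτ hMτ h0
      (fun t ht => hmem t ht.1) (fun t ht => hφ t ht.1)
  -- Long times are reached by composing short-time maps, all with the same bound on `τ`.
  have hmul : ∀ n : ℕ, ∀ τ, 0 ≤ τ → 2 * (M.toNNReal : ℝ) * τ ≤ 1 →
      ContDiffOn ℝ 1 (φ (n * τ)) K := by
    intro n τ hτ hMτ
    induction n with
    | zero => exact hsmall _ (by simp) (by simp)
    | succ n ih =>
      have : φ ((n + 1 : ℕ) * τ) = φ τ ∘ φ (n * τ) := by
        ext x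
        rw [Function.comp_apply, ← hadd]
        congr 1
        push_cast
        ring
      rw [this]
      exact (hsmall τ hτ hMτ).comp ih fun x hx => hmem _ (by positivity) x hx
  obtain ⟨n, hn⟩ := exists_nat_ge (2 * (M.toNNReal : ℝ) * t)
  have hn1 : (0 : ℝ) < n + 1 := by positivity
  have := hmul (n + 1) (t / (n + 1)) (by positivity) (by
    rw [← mul_div_assoc, div_le_one hn1]; linarith)
  have he : ((n + 1 : ℕ) : ℝ) * (t / (n + 1)) = t := by push_cast; field_simp
  rwa [he] at this

end SmoothDependence

/-! ### The closed disc and its radial retraction -/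

section DiscGeometry

theorem isCompact_closedDisc : IsCompact closedDisc := isCompact_closedBall 0 1

theorem convex_closedDisc : Convex ℝ closedDisc := convex_closedBall 0 1

theorem isOpen_openDisc : IsOpen openDisc := Metric.isOpen_ball

theorem openDisc_subset_closedDisc : openDisc ⊆ closedDisc := Metric.ball_subset_closedBall

theorem closure_openDisc : closure openDisc = closedDisc := closure_ball 0 one_ne_zero

theorem mem_closedDisc {z : ℂ} : z ∈ closedDisc ↔ ‖z‖ ≤ 1 := mem_closedBall_zero_iff

theorem mem_openDisc {z : ℂ} : z ∈ openDisc ↔ ‖z‖ < 1 := mem_ball_zero_iff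

theorem zero_mem_openDisc : (0 : ℂ) ∈ openDisc := by simp [mem_openDisc]

theorem zero_mem_closedDisc : (0 : ℂ) ∈ closedDisc := by simp [mem_closedDisc]

theorem uniqueDiffOn_closedDisc : UniqueDiffOn ℝ closedDisc := by
  refine uniqueDiffOn_convex convex_closedDisc ⟨0, ?_⟩
  exact mem_interior.2 ⟨openDisc, openDisc_subset_closedDisc, isOpen_openDisc, zero_mem_openDisc⟩

theorem mem_openDisc_or_norm_eq_one {z : ℂ} (hz : z ∈ closedDisc) : z ∈ openDisc ∨ ‖z‖ = 1 := by
  rw [mem_openDisc]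
  exact (mem_closedDisc.1 hz).lt_or_eq

theorem closedDisc_mem_nhds {z : ℂ} (hz : z ∈ openDisc) : closedDisc ∈ nhds z :=
  Filter.mem_of_superset (isOpen_openDisc.mem_nhds hz) openDisc_subset_closedDisc

/-- The radial retraction of the plane onto the closed unit disc. -/
noncomputable def radialProj (z : ℂ) : ℂ := (max 1 ‖z‖)⁻¹ • z

theorem radialProj_mem (z : ℂ) : radialProj z ∈ closedDisc := by
  have h : 0 < max 1 ‖z‖ := lt_max_of_lt_left one_pos
  rw [mem_closedDisc, radialProj, norm_smul, norm_inv, Real.norm_of_nonneg h.le,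
    inv_mul_le_iff₀ h, mul_one]
  exact le_max_right _ _

theorem radialProj_of_mem {z : ℂ} (hz : z ∈ closedDisc) : radialProj z = z := by
  rw [radialProj, max_eq_left (mem_closedDisc.1 hz), inv_one, one_smul]

theorem norm_smul_radialProj {z : ℂ} (hz : 1 ≤ ‖z‖) : ‖z‖ • radialProj z = z := by
  rw [radialProj, max_eq_right hz, smul_smul, mul_inv_cancel₀ (by linarith), one_smul]

theorem norm_radialProj {z : ℂ} (hz : 1 ≤ ‖z‖) : ‖radialProj z‖ = 1 := by
  rw [radialProj, max_eq_right hz, norm_smul, norm_inv, norm_norm, inv_mul_cancel₀ (by linarith)]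

theorem lipschitzWith_radialProj : LipschitzWith 2 radialProj := by
  refine LipschitzWith.of_dist_le_mul fun x y => ?_
  rw [dist_eq_norm, dist_eq_norm]
  set a := max 1 ‖x‖ with ha
  set b := max 1 ‖y‖ with hb
  have ha1 : 1 ≤ a := le_max_left _ _
  have hb1 : 1 ≤ b := le_max_left _ _
  have hyb : ‖y‖ ≤ b := le_max_right _ _
  have hab : |b - a| ≤ ‖x - y‖ := by
    have h1 : |b - a| ≤ |‖y‖ - ‖x‖| := by
      have := abs_max_sub_max_le_max 1 ‖y‖ 1 ‖x‖
      simpa [ha, hb] using this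
    exact h1.trans (by rw [norm_sub_rev]; exact abs_norm_sub_norm_le y x)
  -- Here `‖b⁻¹ • y‖ ≤ 1` and `|b - a| ≤ ‖x - y‖`: each summand contributes one unit to the
  -- Lipschitz constant `2`.
  have hx : radialProj x - radialProj y = a⁻¹ • ((x - y) + (b - a) • (b⁻¹ • y)) := by
    have ha0 : (a : ℂ) ≠ 0 := by exact_mod_cast (by linarith : a ≠ 0)
    have hb0 : (b : ℂ) ≠ 0 := by exact_mod_cast (by linarith : b ≠ 0)
    simp only [radialProj, ← ha, ← hb, Complex.real_smul]
    push_cast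
    field_simp
    ring
  rw [hx, norm_smul, norm_inv, Real.norm_of_nonneg (by linarith : 0 ≤ a)]
  have h2 : ‖(x - y) + (b - a) • (b⁻¹ • y)‖ ≤ 2 * ‖x - y‖ := by
    refine (norm_add_le _ _).trans ?_
    have h3 : ‖b⁻¹ • y‖ ≤ 1 := by
      rw [norm_smul, norm_inv, Real.norm_of_nonneg (by linarith : 0 ≤ b),
        inv_mul_le_iff₀ (by linarith), mul_one]
      exact hyb
    have h4 : ‖(b - a) • (b⁻¹ • y)‖ ≤ ‖x - y‖ * 1 := by
      rw [norm_smul]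
      exact mul_le_mul hab h3 (norm_nonneg _) (norm_nonneg _)
    linarith
  calc a⁻¹ * ‖(x - y) + (b - a) • (b⁻¹ • y)‖ ≤ 1 * (2 * ‖x - y‖) := by
        gcongr
        exact inv_le_one_of_one_le₀ ha1
    _ = _ := by simp

end DiscGeometry

/-! ### Inward-pointing fields and forward invariance of the disc -/

section DiscSemiflow

theorem exists_lipschitzOnWith_closedDisc {X : ℂ → ℂ} (hX : ContDiffOn ℝ 1 X closedDisc) :
    ∃ K : NNReal, LipschitzOnWith K X closedDisc := by
  obtain ⟨M, hM⟩ := isCompact_closedDisc.exists_bound_of_continuousOn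
    (hX.continuousOn_fderivWithin uniqueDiffOn_closedDisc le_rfl)
  exact ⟨M.toNNReal, convex_closedDisc.lipschitzOnWith_of_nnnorm_fderivWithin_le
    (hX.differentiableOn one_ne_zero) fun x hx => (hM x hx).trans (Real.le_coe_toNNReal M)⟩

theorem exists_lipschitzWith_comp_radialProj {X : ℂ → ℂ} (hX : ContDiffOn ℝ 1 X closedDisc) :
    ∃ K : NNReal, LipschitzWith K (X ∘ radialProj) := by
  obtain ⟨K, hK⟩ := exists_lipschitzOnWith_closedDisc hX
  exact ⟨K * 2, lipschitzOnWith_univ.1 <|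
    hK.comp lipschitzWith_radialProj.lipschitzOnWith fun z _ => radialProj_mem z⟩

theorem exists_isGlobalFlow_comp_radialProj {X : ℂ → ℂ} (hX : ContDiffOn ℝ 1 X closedDisc) :
    ∃ Φ, IsGlobalFlow (X ∘ radialProj) Φ := by
  obtain ⟨K, hK⟩ := exists_lipschitzWith_comp_radialProj hX
  obtain ⟨C, hC⟩ := isCompact_closedDisc.exists_bound_of_continuousOn hX.continuousOn
  exact exists_isGlobalFlow (C := C.toNNReal) hK
    fun z => (hC _ (radialProj_mem z)).trans (Real.le_coe_toNNReal C)

theorem IsGlobalFlow.hasDerivAt_of_mem {X : ℂ → ℂ} {Φ : ℝ → ℂ → ℂ}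
    (hΦ : IsGlobalFlow (X ∘ radialProj) Φ) {t : ℝ} {z : ℂ} (h : Φ t z ∈ closedDisc) :
    HasDerivAt (fun s => Φ s z) (X (Φ t z)) t := by
  have := hΦ.deriv t z
  rwa [Function.comp_apply, radialProj_of_mem h] at this

/-- If `X` points inward on the unit circle, the closed disc is forward invariant. -/
theorem IsGlobalFlow.mem_closedDisc_of_inward {X : ℂ → ℂ} {Φ : ℝ → ℂ → ℂ}
    (hΦ : IsGlobalFlow (X ∘ radialProj) Φ)
    (hin : ∀ z : ℂ, ‖z‖ = 1 → (X z * (starRingEnd ℂ) z).re ≤ 0) {t : ℝ} (ht : 0 ≤ t) {z : ℂ}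
    (hz : z ∈ closedDisc) : Φ t z ∈ closedDisc := by
  have hin' : ∀ y : ℂ, 1 ≤ ‖y‖ → inner ℝ y (X (radialProj y)) ≤ 0 := by
    intro y hy
    have h1 := hin _ (norm_radialProj hy)
    have h2 : (starRingEnd ℂ) y = ‖y‖ * (starRingEnd ℂ) (radialProj y) := by
      conv_lhs => rw [← norm_smul_radialProj hy]
      rw [Complex.real_smul, map_mul, Complex.conj_ofReal]
    rw [Complex.inner, h2, mul_left_comm, Complex.re_ofReal_mul]
    exact mul_nonpos_of_nonneg_of_nonpos (norm_nonneg _) h1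
  have hd : ∀ s, HasDerivAt (fun s => ‖Φ s z‖ ^ 2)
      (2 * inner ℝ (Φ s z) (X (radialProj (Φ s z)))) s := fun s => (hΦ.deriv s z).norm_sq
  -- The comparison needs a strict inequality of slopes: where `‖Φ s z‖ ^ 2` meets the barrier it is
  -- at least `1`, so its derivative is at most `0 < ε`.
  have hle : ∀ ε > 0, ‖Φ t z‖ ^ 2 ≤ 1 + ε * (t + 1) := by
    intro ε hε
    refine image_le_of_deriv_right_lt_deriv_boundary (f := fun s => ‖Φ s z‖ ^ 2)
      (B := fun s => 1 + ε * (s + 1)) (B' := fun _ => ε) (a := 0) (b := t)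
      (fun s _ => (hd s).continuousAt.continuousWithinAt) (fun s _ => (hd s).hasDerivWithinAt)
      ?_ (fun s => ?_) (fun s hs hsB => ?_) ⟨ht, le_rfl⟩
    · have := mem_closedDisc.1 hz
      simp only [hΦ.init]
      nlinarith [norm_nonneg z]
    · simpa using (((hasDerivAt_id s).add_const 1).const_mul ε).const_add 1
    · have h1 : 1 ≤ ‖Φ s z‖ := by
        have : 0 ≤ ε * (s + 1) := by have := hs.1; positivity
        have h2 : 1 ≤ ‖Φ s z‖ ^ 2 := by linarith
        nlinarith [norm_nonneg (Φ s z)]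
      linarith [hin' _ h1]
  rw [mem_closedDisc]
  have h2 : ‖Φ t z‖ ^ 2 ≤ 1 := by
    refine le_of_forall_pos_le_add fun ε hε => ?_
    have := hle (ε / (t + 1)) (by positivity)
    rwa [div_mul_cancel₀ _ (by positivity)] at this
  nlinarith [norm_nonneg (Φ t z)]

/-- The flow of an inward pointing `C¹` field is `C¹` up to the boundary for positive times. -/
theorem IsGlobalFlow.contDiffOn_of_inward {X : ℂ → ℂ} {Φ : ℝ → ℂ → ℂ}
    (hΦ : IsGlobalFlow (X ∘ radialProj) Φ) (hX : ContDiffOn ℝ 1 X closedDisc)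
    (hin : ∀ z : ℂ, ‖z‖ = 1 → (X z * (starRingEnd ℂ) z).re ≤ 0) {t : ℝ} (ht : 0 ≤ t) :
    ContDiffOn ℝ 1 (Φ t) closedDisc := by
  obtain ⟨K, hK⟩ := exists_lipschitzWith_comp_radialProj hX
  exact contDiffOn_semiflow isCompact_closedDisc convex_closedDisc uniqueDiffOn_closedDisc hX
    (fun x _ => hΦ.init x) (fun t ht x hx => hΦ.mem_closedDisc_of_inward hin ht hx)
    (fun t ht x hx => hΦ.hasDerivAt_of_mem (hΦ.mem_closedDisc_of_inward hin ht hx))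
    (hΦ.map_add hK) ht

end DiscSemiflow

/-! ### The stream function -/

section StreamFunction

/-- The bilinear form `(w, v) ↦ Im (conj w * v)`, i.e. the determinant of `w` and `v`. -/
noncomputable def streamForm : ℂ →L[ℝ] ℂ →L[ℝ] ℝ :=
  (ContinuousLinearMap.compL ℝ ℂ ℂ ℝ Complex.imCLM).comp
    ((ContinuousLinearMap.mul ℝ ℂ).comp (Complex.conjCLE : ℂ →L[ℝ] ℂ))

@[simp]
theorem streamForm_apply (w v : ℂ) : streamForm w v = w.re * v.im - w.im * v.re := by
  simp [streamForm]
  ring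

/-- The identity passes from the open disc to its closure by continuity of the derivative; the
primitive is built directly on the closed disc. -/
theorem IsAdmissibleField.div_fderivWithin_eq_zero {W : ℂ → ℂ} (hW : IsAdmissibleField W) :
    ∀ z ∈ closedDisc, (fderivWithin ℝ W closedDisc z 1).re +
      (fderivWithin ℝ W closedDisc z Complex.I).im = 0 := by
  have hc := hW.contDiffOn.continuousOn_fderivWithin uniqueDiffOn_closedDisc le_rfl
  have h1 : ContinuousOn (fun z => (fderivWithin ℝ W closedDisc z 1).re +
      (fderivWithin ℝ W closedDisc z Complex.I).im) closedDisc :=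
    (Complex.continuous_re.comp_continuousOn (hc.clm_apply continuousOn_const)).add
      (Complex.continuous_im.comp_continuousOn (hc.clm_apply continuousOn_const))
  have h2 : Set.EqOn (fun z => (fderivWithin ℝ W closedDisc z 1).re +
      (fderivWithin ℝ W closedDisc z Complex.I).im) (fun _ => 0) openDisc := fun z hz => by
    have := hW.div_eq_zero z hz
    rw [planarDiv, ← fderivWithin_of_mem_nhds (closedDisc_mem_nhds hz)] at this
    exact this
  exact h2.of_subset_closure h1 continuousOn_const openDisc_subset_closedDisc
    closure_openDisc.ge

/-- `H` is a stream function of `W`, up to the sign `s`, normalised to vanish on the unit circle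
and to have its maximum at the origin. -/
structure IsStreamFunction (W : ℂ → ℂ) (s : ℝ) (H : ℂ → ℝ) : Prop where
  sq_eq_one : s * s = 1
  hasFDerivWithinAt : ∀ z ∈ closedDisc, HasFDerivWithinAt H (s • streamForm (W z)) closedDisc z
  eq_zero : ∀ z : ℂ, ‖z‖ = 1 → H z = 0
  pos : ∀ z ∈ openDisc, 0 < H z
  lt_zero : ∀ z ∈ closedDisc, z ≠ 0 → H z < H 0

/-- Poincaré's lemma on a convex set: with `D` the derivative of `W`, `det(D x, y) - det(D y, x) =
div W * det(x, y)`, so closedness is exactly zero divergence. -/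
theorem IsAdmissibleField.exists_primitive {W : ℂ → ℂ} (hW : IsAdmissibleField W) :
    ∃ H : ℂ → ℝ, ∀ z ∈ closedDisc, HasFDerivWithinAt H (streamForm (W z)) closedDisc z := by
  refine convex_closedDisc.exists_forall_hasFDerivWithinAt_of_hasFDerivWithinAt_symmetric
    (ω := fun z => streamForm (W z))
    (dω := fun z => streamForm.comp (fderivWithin ℝ W closedDisc z)) (fun z hz => ?_)
    (fun z hz x _ y _ => ?_)
  · exact streamForm.hasFDerivAt.comp_hasFDerivWithinAt z
      (hW.contDiffOn.differentiableOn one_ne_zero z hz).hasFDerivWithinAt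
  · have hdiv := hW.div_fderivWithin_eq_zero z hz
    have hlin : ∀ v : ℂ, fderivWithin ℝ W closedDisc z v =
        v.re • fderivWithin ℝ W closedDisc z 1 +
          v.im • fderivWithin ℝ W closedDisc z Complex.I := fun v => by
      rw [← map_smul, ← map_smul, ← map_add]
      congr 1
      simp [Complex.re_add_im]
    simp only [ContinuousLinearMap.comp_apply, streamForm_apply]
    rw [hlin x, hlin y]
    simp
    linear_combination (x.re * y.im - x.im * y.re) * hdiv

theorem streamForm_eq_zero_iff {w : ℂ} : streamForm w = 0 ↔ w = 0 := by
  refine ⟨fun h => ?_, fun h => by rw [h, map_zero]⟩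
  have h1 := congrArg (fun L : ℂ →L[ℝ] ℝ => L 1) h
  have h2 := congrArg (fun L : ℂ →L[ℝ] ℝ => L Complex.I) h
  simp at h1 h2
  exact Complex.ext h2 h1

theorem hasDerivAt_circle (θ : ℝ) : HasDerivAt (fun θ : ℝ => Complex.exp (θ * Complex.I))
    (Complex.I * Complex.exp (θ * Complex.I)) θ := by
  have h := ((hasDerivAt_id (θ : ℂ)).mul_const Complex.I).cexp.comp_ofReal
  simpa [mul_comm] using h

theorem circle_mem_closedDisc (θ : ℝ) : Complex.exp (θ * Complex.I) ∈ closedDisc := by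
  rw [mem_closedDisc, Complex.norm_exp_ofReal_mul_I]

/-- Tangency makes `W z` parallel to the circle's velocity `I * z`, so the form vanishes along the
circle. -/
theorem IsAdmissibleField.primitive_circle {W : ℂ → ℂ} (hW : IsAdmissibleField W) {H : ℂ → ℝ}
    (hH : ∀ z ∈ closedDisc, HasFDerivWithinAt H (streamForm (W z)) closedDisc z) {z : ℂ}
    (hz : ‖z‖ = 1) : H z = H 1 := by
  have hd : ∀ θ : ℝ, HasDerivAt (fun θ : ℝ => H (Complex.exp (θ * Complex.I))) 0 θ := by
    intro θ
    have h := (hH _ (circle_mem_closedDisc θ)).comp_hasDerivWithinAt (s := Set.univ) θ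
      (hasDerivAt_circle θ).hasDerivWithinAt (fun x _ => circle_mem_closedDisc x)
    rw [hasDerivWithinAt_univ] at h
    refine h.congr_deriv ?_
    have ht := hW.tangent _ (Complex.norm_exp_ofReal_mul_I θ)
    simp only [Complex.mul_re, Complex.conj_re, Complex.conj_im] at ht
    simp only [streamForm_apply, Complex.mul_re, Complex.mul_im, Complex.I_re, Complex.I_im]
    linarith
  have hconst := is_const_of_deriv_eq_zero (fun θ => (hd θ).differentiableAt)
    (fun θ => (hd θ).deriv) z.arg 0
  have hz' : Complex.exp (z.arg * Complex.I) = z := by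
    have := Complex.norm_mul_exp_arg_mul_I z
    rwa [hz, Complex.ofReal_one, one_mul] at this
  simpa [hz'] using hconst

theorem eq_zero_of_isExtrOn {W : ℂ → ℂ} (hW : IsAdmissibleField W) {H : ℂ → ℝ}
    (hH : ∀ z ∈ closedDisc, HasFDerivWithinAt H (streamForm (W z)) closedDisc z) {z : ℂ}
    (hz : z ∈ openDisc) (he : IsExtrOn H closedDisc z) : z = 0 := by
  have hz' := openDisc_subset_closedDisc hz
  have h1 := (he.isLocalExtr (closedDisc_mem_nhds hz)).hasFDerivAt_eq_zero
    ((hH z hz').hasFDerivAt (closedDisc_mem_nhds hz))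
  exact (hW.zero_iff z hz').1 (streamForm_eq_zero_iff.1 h1)

/-- Extrema over the compact disc are attained at the origin or on the circle, which fixes the
minimum `0` and the maximum `H 0`. Attaining either at another interior point would give a second
zero of `W`. -/
theorem isStreamFunction_of_pos {W : ℂ → ℂ} (hW : IsAdmissibleField W) {s : ℝ} (hs : s * s = 1)
    {H : ℂ → ℝ}
    (hH : ∀ z ∈ closedDisc, HasFDerivWithinAt H (s • streamForm (W z)) closedDisc z)
    (h1 : ∀ z : ℂ, ‖z‖ = 1 → H z = 0) (h0 : 0 < H 0) : IsStreamFunction W s H := by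
  have hs0 : s ≠ 0 := fun h => by simp [h] at hs
  have hext : ∀ z ∈ openDisc, IsExtrOn H closedDisc z → z = 0 := by
    intro z hz he
    have hz' := openDisc_subset_closedDisc hz
    have h1 := (he.isLocalExtr (closedDisc_mem_nhds hz)).hasFDerivAt_eq_zero
      ((hH z hz').hasFDerivAt (closedDisc_mem_nhds hz))
    exact (hW.zero_iff z hz').1 (streamForm_eq_zero_iff.1 ((smul_eq_zero.1 h1).resolve_left hs0))
  have hc : ContinuousOn H closedDisc := fun z hz => (hH z hz).continuousWithinAt
  have hne : closedDisc.Nonempty := ⟨0, zero_mem_closedDisc⟩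
  have hnonneg : ∀ z ∈ closedDisc, 0 ≤ H z := by
    obtain ⟨m, hm, hmin⟩ := isCompact_closedDisc.exists_isMinOn hne hc
    have : 0 ≤ H m := by
      rcases mem_openDisc_or_norm_eq_one hm with h | h
      · rw [hext m h hmin.isExtr]; exact h0.le
      · rw [h1 m h]
    exact fun z hz => this.trans (hmin hz)
  have hle : ∀ z ∈ closedDisc, H z ≤ H 0 := by
    obtain ⟨m, hm, hmax⟩ := isCompact_closedDisc.exists_isMaxOn hne hc
    have : H m ≤ H 0 := by
      rcases mem_openDisc_or_norm_eq_one hm with h | h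
      · rw [hext m h hmax.isExtr]
      · rw [h1 m h]; exact h0.le
    exact fun z hz => (hmax hz).trans this
  refine ⟨hs, hH, h1, fun z hz => ?_, fun z hz hz0 => ?_⟩
  · refine (hnonneg z (openDisc_subset_closedDisc hz)).lt_of_ne fun h => ?_
    have hmin : IsMinOn H closedDisc z := fun w hw => by
      show H z ≤ H w
      rw [← h]
      exact hnonneg w hw
    rw [hext z hz hmin.isExtr] at h
    exact h0.ne h
  · refine (hle z hz).lt_of_ne fun h => ?_
    rcases mem_openDisc_or_norm_eq_one hz with hz' | hz'
    · have hmax : IsMaxOn H closedDisc z := fun w hw => by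
        show H w ≤ H z
        rw [h]
        exact hle w hw
      exact hz0 (hext z hz' hmax.isExtr)
    · rw [h1 z hz'] at h
      exact h0.ne h

theorem IsAdmissibleField.exists_isStreamFunction {W : ℂ → ℂ} (hW : IsAdmissibleField W) :
    ∃ s H, IsStreamFunction W s H := by
  obtain ⟨H, hH⟩ := hW.exists_primitive
  rcases lt_trichotomy (H 0) (H 1) with h | h | h
  · refine ⟨-1, fun z => -1 * (H z - H 1), isStreamFunction_of_pos hW (by norm_num)
      (fun z hz => ((hH z hz).sub_const _).const_mul (-1)) (fun z hz => ?_) (by linarith)⟩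
    rw [hW.primitive_circle hH hz, sub_self, mul_zero]
  -- If `H 0` equals the boundary value, maximum and minimum coincide and `H` is constant; then `1 /
  -- 2` is an interior extremum, hence a zero of `W`.
  · exfalso
    have hc : ContinuousOn H closedDisc := fun z hz => (hH z hz).continuousWithinAt
    have hval : ∀ z ∈ closedDisc, IsExtrOn H closedDisc z → H z = H 0 := fun z hz he => by
      rcases mem_openDisc_or_norm_eq_one hz with h' | h'
      · rw [eq_zero_of_isExtrOn hW hH h' he]
      · rw [hW.primitive_circle hH h', h]
    obtain ⟨m, hm, hmin⟩ := isCompact_closedDisc.exists_isMinOn ⟨0, zero_mem_closedDisc⟩ hc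
    obtain ⟨n, hn, hmax⟩ := isCompact_closedDisc.exists_isMaxOn ⟨0, zero_mem_closedDisc⟩ hc
    have hhalf : (1 / 2 : ℂ) ∈ openDisc := by rw [mem_openDisc]; norm_num
    have hmax' : IsMaxOn H closedDisc (1 / 2) := fun w hw => by
      have h1 : H w ≤ H n := hmax hw
      have h2 : H m ≤ H (1 / 2) := hmin (openDisc_subset_closedDisc hhalf)
      rw [hval n hn hmax.isExtr] at h1
      rw [hval m hm hmin.isExtr] at h2
      exact h1.trans h2
    have := eq_zero_of_isExtrOn hW hH hhalf hmax'.isExtr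
    norm_num at this
  · refine ⟨1, fun z => 1 * (H z - H 1), isStreamFunction_of_pos hW (by norm_num)
      (fun z hz => ((hH z hz).sub_const _).const_mul 1) (fun z hz => ?_) (by linarith)⟩
    rw [hW.primitive_circle hH hz, sub_self, mul_zero]

end StreamFunction

/-! ### The ascent field and the parametrization of level sets -/

section AscentField

/-- A smooth positive function on `[0, ∞)` which is the identity on `[m, ∞)`. -/
noncomputable def cutoffId (m x : ℝ) : ℝ := x + m * (1 - Real.smoothTransition (x / m))

theorem contDiff_cutoffId (m : ℝ) : ContDiff ℝ 1 (cutoffId m) := by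
  unfold cutoffId
  exact contDiff_id.add (contDiff_const.mul (contDiff_const.sub
    (Real.smoothTransition.contDiff.comp (contDiff_id.div_const m))))

theorem le_cutoffId {m x : ℝ} (hm : 0 < m) : x ≤ cutoffId m x := by
  have := Real.smoothTransition.le_one (x / m)
  unfold cutoffId
  nlinarith

theorem cutoffId_pos {m x : ℝ} (hm : 0 < m) (hx : 0 ≤ x) : 0 < cutoffId m x := by
  rcases hx.eq_or_lt with rfl | h
  · simpa [cutoffId] using hm
  · exact h.trans_le (le_cutoffId hm)

theorem cutoffId_of_le {m x : ℝ} (hm : 0 < m) (hx : m ≤ x) : cutoffId m x = x := by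
  rw [cutoffId, Real.smoothTransition.one_of_one_le ((one_le_div hm).2 hx)]
  ring

/-- The rotation of `W` by a right angle, normalised so that a stream function of `W` grows with
unit speed along it wherever `|W|² ≥ m`. -/
noncomputable def ascentField (W : ℂ → ℂ) (s m : ℝ) (z : ℂ) : ℂ :=
  (s / cutoffId m (Complex.normSq (W z))) • (Complex.I * W z)

/-- The growth rate of the stream function along `ascentField`. -/
noncomputable def ascentRate (W : ℂ → ℂ) (m : ℝ) (z : ℂ) : ℝ :=
  Complex.normSq (W z) / cutoffId m (Complex.normSq (W z))

theorem contDiff_normSq : ContDiff ℝ 1 (fun z : ℂ => Complex.normSq z) := by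
  have : (fun z : ℂ => Complex.normSq z) =
      fun z : ℂ => Complex.reCLM z * Complex.reCLM z + Complex.imCLM z * Complex.imCLM z := by
    ext z
    simp [Complex.normSq_apply]
  rw [this]
  exact (Complex.reCLM.contDiff.mul Complex.reCLM.contDiff).add
    (Complex.imCLM.contDiff.mul Complex.imCLM.contDiff)

variable {W : ℂ → ℂ} {s m : ℝ} {H : ℂ → ℝ}

/-- The cutoff keeps the denominator positive at the origin, where `|W|²` vanishes. -/
theorem contDiffOn_ascentField (hW : ContDiffOn ℝ 1 W closedDisc) (hm : 0 < m) :
    ContDiffOn ℝ 1 (ascentField W s m) closedDisc := by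
  unfold ascentField
  refine ContDiffOn.smul (contDiffOn_const.div ?_ fun z _ => ?_) (contDiffOn_const.mul hW)
  · exact (contDiff_cutoffId m).comp_contDiffOn (contDiff_normSq.comp_contDiffOn hW)
  · exact (cutoffId_pos hm (Complex.normSq_nonneg _)).ne'

theorem continuousOn_ascentRate (hW : ContinuousOn W closedDisc) (hm : 0 < m) :
    ContinuousOn (ascentRate W m) closedDisc := by
  have h := contDiff_normSq.continuous.comp_continuousOn hW
  exact h.div ((contDiff_cutoffId m).continuous.comp_continuousOn h) fun z _ =>
    (cutoffId_pos hm (Complex.normSq_nonneg _)).ne'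

theorem ascentRate_nonneg (hm : 0 < m) (z : ℂ) : 0 ≤ ascentRate W m z :=
  div_nonneg (Complex.normSq_nonneg _) (cutoffId_pos hm (Complex.normSq_nonneg _)).le

theorem ascentRate_le_one (hm : 0 < m) (z : ℂ) : ascentRate W m z ≤ 1 :=
  (div_le_one (cutoffId_pos hm (Complex.normSq_nonneg _))).2 (le_cutoffId hm)

theorem ascentRate_pos (hm : 0 < m) {z : ℂ} (hz : W z ≠ 0) : 0 < ascentRate W m z :=
  div_pos (Complex.normSq_pos.2 hz) (cutoffId_pos hm (Complex.normSq_nonneg _))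

theorem ascentRate_eq_one (hm : 0 < m) {z : ℂ} (hz : m ≤ Complex.normSq (W z)) :
    ascentRate W m z = 1 := by
  rw [ascentRate, cutoffId_of_le hm hz, div_self (hm.trans_le hz).ne']

namespace IsStreamFunction

theorem continuousOn (hH : IsStreamFunction W s H) : ContinuousOn H closedDisc := fun z hz =>
  (hH.hasFDerivWithinAt z hz).continuousWithinAt

theorem nonneg (hH : IsStreamFunction W s H) {z : ℂ} (hz : z ∈ closedDisc) : 0 ≤ H z := by
  rcases mem_openDisc_or_norm_eq_one hz with h | h
  · exact (hH.pos z h).le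
  · rw [hH.eq_zero z h]

theorem comp_hasDerivWithinAt (hH : IsStreamFunction W s H) {y : ℝ → ℂ} {v : ℂ} {S : Set ℝ}
    {t : ℝ} (hy : HasDerivWithinAt y v S t) (hS : Set.MapsTo y S closedDisc) (ht : t ∈ S) :
    HasDerivWithinAt (fun r => H (y r)) (s * streamForm (W (y t)) v) S t :=
  (hH.hasFDerivWithinAt (y t) (hS ht)).comp_hasDerivWithinAt t hy hS

theorem streamForm_ascentField (hH : IsStreamFunction W s H) (z : ℂ) :
    s * streamForm (W z) (ascentField W s m z) = ascentRate W m z := by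
  rw [ascentField, map_smul, ascentRate, Complex.normSq_apply, smul_eq_mul, streamForm_apply]
  simp only [Complex.mul_re, Complex.mul_im, Complex.I_re, Complex.I_im]
  linear_combination ((W z).re * (W z).re + (W z).im * (W z).im) /
    cutoffId m ((W z).re * (W z).re + (W z).im * (W z).im) * hH.sq_eq_one

/-- A circle point minimises `H`, so the derivative of `H` towards the centre is nonnegative. As `dH
= s * det(W, ·)`, this is the sign condition on the rotated field. -/
theorem ascentField_inward (hH : IsStreamFunction W s H) (hm : 0 < m) (z : ℂ) (hz : ‖z‖ = 1) :
    (ascentField W s m z * (starRingEnd ℂ) z).re ≤ 0 := by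
  have hz' : z ∈ closedDisc := mem_closedDisc.2 hz.le
  have hmin : IsMinOn H closedDisc z := fun w hw => by
    show H z ≤ H w
    rw [hH.eq_zero z hz]
    exact hH.nonneg hw
  have h := hmin.localize.hasFDerivWithinAt_nonneg (hH.hasFDerivWithinAt z hz')
    (sub_mem_posTangentConeAt_of_segment_subset
      (convex_closedDisc.segment_subset hz' zero_mem_closedDisc))
  have hc := cutoffId_pos hm (Complex.normSq_nonneg (W z))
  simp only [zero_sub, map_neg, smul_apply, smul_eq_mul, streamForm_apply]
    at h
  rw [ascentField, Complex.real_smul, mul_assoc, Complex.re_ofReal_mul, div_mul_eq_mul_div]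
  refine div_nonpos_of_nonpos_of_nonneg ?_ hc.le
  simp only [Complex.mul_re, Complex.mul_im, Complex.I_re, Complex.I_im, Complex.conj_re,
    Complex.conj_im]
  linarith

section AlongAscent

variable {y : ℝ → ℂ} {a b : ℝ}

theorem hasDerivWithinAt_ascent (hH : IsStreamFunction W s H)
    (hy : ∀ t ∈ Set.Icc a b, y t ∈ closedDisc)
    (hd : ∀ t ∈ Set.Icc a b, HasDerivAt y (ascentField W s m (y t)) t) :
    ∀ t ∈ Set.Icc a b,
      HasDerivWithinAt (fun r => H (y r)) (ascentRate W m (y t)) (Set.Icc a b) t := fun t ht => by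
  rw [← hH.streamForm_ascentField]
  exact hH.comp_hasDerivWithinAt (hd t ht).hasDerivWithinAt hy ht

theorem le_add_of_ascent (hH : IsStreamFunction W s H) (hm : 0 < m) (hab : a ≤ b)
    (hy : ∀ t ∈ Set.Icc a b, y t ∈ closedDisc)
    (hd : ∀ t ∈ Set.Icc a b, HasDerivAt y (ascentField W s m (y t)) t) :
    H (y b) ≤ H (y a) + (b - a) := by
  have h := hH.hasDerivWithinAt_ascent hy hd
  refine image_le_of_deriv_right_le_deriv_boundary (f := fun r => H (y r))
    (B := fun r => H (y a) + (r - a)) (B' := fun _ => 1)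
    (fun t ht => (h t ht).continuousWithinAt)
    (fun t ht => (h t ⟨ht.1, ht.2.le⟩).mono_of_mem_nhdsWithin (Icc_mem_nhdsGE_of_mem ht))
    (by simp) (by fun_prop)
    (fun t _ => (((hasDerivAt_id t).sub_const a).const_add _).hasDerivWithinAt)
    (fun t _ => ascentRate_le_one hm _) ⟨hab, le_rfl⟩

theorem add_mul_le_of_ascent (hH : IsStreamFunction W s H) (hab : a ≤ b) {κ : ℝ}
    (hy : ∀ t ∈ Set.Icc a b, y t ∈ closedDisc)
    (hd : ∀ t ∈ Set.Icc a b, HasDerivAt y (ascentField W s m (y t)) t)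
    (hκ : ∀ t ∈ Set.Icc a b, κ ≤ ascentRate W m (y t)) :
    H (y a) + κ * (b - a) ≤ H (y b) := by
  have h := hH.hasDerivWithinAt_ascent hy hd
  refine image_le_of_deriv_right_le_deriv_boundary (B := fun r => H (y r))
    (f := fun r => H (y a) + κ * (r - a)) (f' := fun _ => κ)
    (B' := fun t => ascentRate W m (y t)) (a := a) (b := b) (by fun_prop)
    (fun t _ => by
      simpa using ((((hasDerivAt_id t).sub_const a).const_mul κ).const_add
        (H (y a))).hasDerivWithinAt)
    (by simp) (fun t ht => (h t ht).continuousWithinAt)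
    (fun t ht => (h t ⟨ht.1, ht.2.le⟩).mono_of_mem_nhdsWithin (Icc_mem_nhdsGE_of_mem ht))
    (fun t ht => hκ t ⟨ht.1, ht.2.le⟩) ⟨hab, le_rfl⟩

theorem le_of_ascent (hH : IsStreamFunction W s H) (hm : 0 < m) (hab : a ≤ b)
    (hy : ∀ t ∈ Set.Icc a b, y t ∈ closedDisc)
    (hd : ∀ t ∈ Set.Icc a b, HasDerivAt y (ascentField W s m (y t)) t) :
    H (y a) ≤ H (y b) := by
  simpa using hH.add_mul_le_of_ascent (κ := 0) hab hy hd fun t _ => ascentRate_nonneg hm _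

theorem eq_add_of_ascent (hH : IsStreamFunction W s H) (hm : 0 < m) (hab : a ≤ b)
    (hy : ∀ t ∈ Set.Icc a b, y t ∈ closedDisc)
    (hd : ∀ t ∈ Set.Icc a b, HasDerivAt y (ascentField W s m (y t)) t)
    (hκ : ∀ t ∈ Set.Icc a b, m ≤ Complex.normSq (W (y t))) :
    H (y b) = H (y a) + (b - a) := by
  refine le_antisymm (hH.le_add_of_ascent hm hab hy hd) ?_
  simpa using hH.add_mul_le_of_ascent (κ := 1) hab hy hd
    fun t ht => (ascentRate_eq_one hm (hκ t ht)).ge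

end AlongAscent

/-- The sublevel set is compact and misses the origin. With this `m`, the cutoff is inactive up to
level `c` and `H` grows there at exactly unit speed. -/
theorem exists_normSq_lower_bound (hH : IsStreamFunction W s H) (hW : IsAdmissibleField W) {c : ℝ}
    (hc : c < H 0) : ∃ m > 0, ∀ z ∈ closedDisc, H z ≤ c → m ≤ Complex.normSq (W z) := by
  have hcl : IsClosed (closedDisc ∩ H ⁻¹' Set.Iic c) :=
    hH.continuousOn.preimage_isClosed_of_isClosed isCompact_closedDisc.isClosed isClosed_Iic
  have hcpt := isCompact_closedDisc.of_isClosed_subset hcl Set.inter_subset_left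
  rcases (closedDisc ∩ H ⁻¹' Set.Iic c).eq_empty_or_nonempty with he | hne
  · refine ⟨1, one_pos, fun z hz hzc => ?_⟩
    have : z ∈ closedDisc ∩ H ⁻¹' Set.Iic c := ⟨hz, hzc⟩
    rw [he] at this
    exact this.elim
  · obtain ⟨w, hw, hmin⟩ := hcpt.exists_isMinOn hne
      ((Complex.continuous_normSq.comp_continuousOn hW.contDiffOn.continuousOn).mono
        Set.inter_subset_left)
    refine ⟨Complex.normSq (W w), Complex.normSq_pos.2 fun h => ?_, fun z hz hzc => hmin ⟨hz, hzc⟩⟩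
    have := hw.2
    rw [(hW.zero_iff w hw.1).1 h] at this
    exact absurd this (not_le.2 hc)

section AscentFlow

variable {Φ : ℝ → ℂ → ℂ} {c : ℝ}

/-- The growth rate never exceeds `1`, so the trajectory stays below level `c` up to time `t`; there
the rate equals `1`. -/
theorem eq_time_of_ascentFlow (hH : IsStreamFunction W s H) (hm : 0 < m)
    (hmc : ∀ z ∈ closedDisc, H z ≤ c → m ≤ Complex.normSq (W z))
    (hΦ : IsGlobalFlow (ascentField W s m ∘ radialProj) Φ) {u : ℂ} (hu : u ∈ closedDisc) {t : ℝ}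
    (ht0 : 0 ≤ t) (htc : H u + t ≤ c) : H (Φ t u) = H u + t := by
  have hmem : ∀ r, 0 ≤ r → Φ r u ∈ closedDisc := fun r hr =>
    hΦ.mem_closedDisc_of_inward (hH.ascentField_inward hm) hr hu
  have hd : ∀ r, 0 ≤ r → HasDerivAt (fun r => Φ r u) (ascentField W s m (Φ r u)) r :=
    fun r hr => hΦ.hasDerivAt_of_mem (hmem r hr)
  have hle : ∀ r ∈ Set.Icc 0 t, H (Φ r u) ≤ c := fun r hr => by
    have := hH.le_add_of_ascent (y := fun r => Φ r u) hm hr.1 (fun r hr => hmem r hr.1)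
      (fun r hr => hd r hr.1)
    simp only [hΦ.init, sub_zero] at this
    linarith [hr.2]
  have := hH.eq_add_of_ascent (y := fun r => Φ r u) hm ht0 (fun r hr => hmem r hr.1)
      (fun r hr => hd r hr.1) (fun r hr => hmc _ (hmem r hr.1) (hle r hr))
  simpa [hΦ.init] using this

/-- Every point of a level set is reached from the unit circle along the ascent flow. -/
theorem exists_circle_ascentFlow_eq (hH : IsStreamFunction W s H) (hm : 0 < m)
    (hmc : ∀ z ∈ closedDisc, H z ≤ c → m ≤ Complex.normSq (W z))
    (hW : ContDiffOn ℝ 1 W closedDisc)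
    (hΦ : IsGlobalFlow (ascentField W s m ∘ radialProj) Φ) {z : ℂ} (hz : z ∈ closedDisc)
    (hzc : H z ≤ c) : ∃ u : ℂ, ‖u‖ = 1 ∧ Φ (H z) u = z := by
  have hc := hH.nonneg hz
  -- Backwards the extended flow may leave the disc, but only through the circle. If it stayed
  -- inside during time `H z`, then `H` would drop to `0` at an interior point.
  obtain ⟨r, hr, hr1⟩ : ∃ r ∈ Set.Icc (-H z) 0, ‖Φ r z‖ = 1 := by
    by_contra! hne
    have hcont : ContinuousOn (fun r => ‖Φ r z‖) (Set.Icc (-H z) 0) := fun r _ =>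
      (hΦ.deriv r z).continuousAt.norm.continuousWithinAt
    have h0 : (0 : ℝ) ∈ Set.Icc (-H z) 0 := ⟨by linarith, le_rfl⟩
    have hopen : ∀ r ∈ Set.Icc (-H z) 0, Φ r z ∈ openDisc := by
      intro r hr
      rw [mem_openDisc]
      by_contra! hge
      have h1 : ‖Φ 0 z‖ ≤ 1 := by rw [hΦ.init]; exact mem_closedDisc.1 hz
      obtain ⟨q, hq, hq1⟩ := isPreconnected_Icc.intermediate_value h0 hr hcont ⟨h1, hge⟩
      exact hne q hq hq1
    have hmem : ∀ r ∈ Set.Icc (-H z) 0, Φ r z ∈ closedDisc := fun r hr =>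
      openDisc_subset_closedDisc (hopen r hr)
    have hd : ∀ r ∈ Set.Icc (-H z) 0,
        HasDerivAt (fun r => Φ r z) (ascentField W s m (Φ r z)) r := fun r hr =>
      hΦ.hasDerivAt_of_mem (hmem r hr)
    have hle : ∀ r ∈ Set.Icc (-H z) 0, H (Φ r z) ≤ c := fun r hr => by
      have := hH.le_of_ascent (y := fun r => Φ r z) hm hr.2
        (fun q hq => hmem q ⟨hr.1.trans hq.1, hq.2⟩) (fun q hq => hd q ⟨hr.1.trans hq.1, hq.2⟩)
      simp only [hΦ.init] at this
      exact this.trans hzc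
    have := hH.eq_add_of_ascent (y := fun r => Φ r z) hm h0.1 hmem hd
      (fun r hr => hmc _ (hmem r hr) (hle r hr))
    simp only [hΦ.init] at this
    have := hH.pos _ (hopen (-H z) ⟨le_rfl, by linarith⟩)
    linarith
  obtain ⟨K, hK⟩ := exists_lipschitzWith_comp_radialProj (contDiffOn_ascentField (s := s) hW hm)
  have hback : Φ (-r) (Φ r z) = z := by
    rw [← hΦ.map_add hK, neg_add_cancel, hΦ.init]
  have h1 := hH.eq_time_of_ascentFlow hm hmc hΦ (mem_closedDisc.2 hr1.le) (t := -r)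
    (by linarith [hr.2]) (by rw [hH.eq_zero _ hr1]; linarith [hr.1])
  rw [hback, hH.eq_zero _ hr1, zero_add] at h1
  exact ⟨Φ r z, hr1, by rw [h1, hback]⟩

/-- A level set of a stream function, other than the origin, is a closed `C¹` curve. -/
theorem exists_contDiff_levelSet_parametrization (hH : IsStreamFunction W s H)
    (hW : IsAdmissibleField W) (hc0 : 0 ≤ c) (hc : c < H 0) :
    ∃ σ : ℝ → ℂ, ContDiff ℝ 1 σ ∧ (∀ θ, σ θ ∈ closedDisc ∧ H (σ θ) = c) ∧
      ∀ z ∈ closedDisc, H z = c → ∃ θ ∈ Set.Icc 0 (2 * Real.pi), σ θ = z := by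
  obtain ⟨m, hm, hmc⟩ := hH.exists_normSq_lower_bound hW hc
  have hV := contDiffOn_ascentField (s := s) hW.contDiffOn hm
  obtain ⟨Φ, hΦ⟩ := exists_isGlobalFlow_comp_radialProj hV
  have hin := hH.ascentField_inward hm
  refine ⟨fun θ => Φ c (Complex.exp (θ * Complex.I)), ?_, fun θ => ⟨?_, ?_⟩, fun z hz hzc => ?_⟩
  · refine (hΦ.contDiffOn_of_inward hV hin hc0).comp_contDiff ?_ circle_mem_closedDisc
    exact (Complex.ofRealCLM.contDiff.mul contDiff_const).cexp
  · exact hΦ.mem_closedDisc_of_inward hin hc0 (circle_mem_closedDisc θ)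
  · have hu := hH.eq_zero _ (Complex.norm_exp_ofReal_mul_I θ)
    have := hH.eq_time_of_ascentFlow hm hmc hΦ (circle_mem_closedDisc θ) hc0
      (by rw [hu, zero_add])
    rwa [hu, zero_add] at this
  · obtain ⟨u, hu, huz⟩ := hH.exists_circle_ascentFlow_eq hm hmc hW.contDiffOn hΦ hz hzc.le
    have hexp : Complex.exp (u.arg * Complex.I) = u := by
      have := Complex.norm_mul_exp_arg_mul_I u
      rwa [hu, Complex.ofReal_one, one_mul] at this
    refine ⟨toIcoMod Real.two_pi_pos 0 u.arg, ?_, ?_⟩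
    · have := toIcoMod_mem_Ico Real.two_pi_pos 0 u.arg
      rw [zero_add] at this
      exact Set.Ico_subset_Icc_self this
    · rw [← huz, hzc]
      rw [toIcoMod]
      push_cast
      rw [sub_mul, zsmul_eq_mul, show ((toIcoDiv Real.two_pi_pos 0 u.arg : ℂ) *
        (2 * (Real.pi : ℂ))) * Complex.I = (toIcoDiv Real.two_pi_pos 0 u.arg : ℂ) *
        (2 * (Real.pi : ℂ) * Complex.I) by ring, Complex.exp_sub,
        Complex.exp_int_mul_two_pi_mul_I, div_one, hexp]

end AscentFlow

end IsStreamFunction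

end AscentField

/-! ### Orbits are level sets, and they are periodic -/

section Orbits

/-- `Ψ` is the flow of an admissible field `W`, extended to the whole plane. -/
structure IsAdmissibleFlow (W : ℂ → ℂ) (Ψ : ℝ → ℂ → ℂ) : Prop where
  isGlobalFlow : IsGlobalFlow (W ∘ radialProj) Ψ
  mem : ∀ t, ∀ z ∈ closedDisc, Ψ t z ∈ closedDisc
  contDiffOn : ∀ t, ContDiffOn ℝ 1 (Ψ t) closedDisc
  map_add : ∀ s t z, Ψ (s + t) z = Ψ s (Ψ t z)

/-- By tangency both `W` and `-W` satisfy the inward condition, so the forward results apply in both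
time directions. -/
theorem IsAdmissibleField.exists_isAdmissibleFlow {W : ℂ → ℂ} (hW : IsAdmissibleField W) :
    ∃ Ψ, IsAdmissibleFlow W Ψ := by
  obtain ⟨Ψ, hΨ⟩ := exists_isGlobalFlow_comp_radialProj hW.contDiffOn
  obtain ⟨K, hK⟩ := exists_lipschitzWith_comp_radialProj hW.contDiffOn
  have hin : ∀ z : ℂ, ‖z‖ = 1 → (W z * (starRingEnd ℂ) z).re ≤ 0 := fun z hz =>
    (hW.tangent z hz).le
  have hin' : ∀ z : ℂ, ‖z‖ = 1 → (-W z * (starRingEnd ℂ) z).re ≤ 0 := fun z hz => by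
    rw [neg_mul, Complex.neg_re, hW.tangent z hz, neg_zero]
  have hneg : IsGlobalFlow ((fun z => -W z) ∘ radialProj) fun t z => Ψ (-t) z := hΨ.neg
  refine ⟨Ψ, hΨ, fun t z hz => ?_, fun t => ?_, hΨ.map_add hK⟩
  · rcases le_total 0 t with ht | ht
    · exact hΨ.mem_closedDisc_of_inward hin ht hz
    · simpa using hneg.mem_closedDisc_of_inward hin' (neg_nonneg.2 ht) hz
  · rcases le_total 0 t with ht | ht
    · exact hΨ.contDiffOn_of_inward hW.contDiffOn hin ht
    · simpa using hneg.contDiffOn_of_inward hW.contDiffOn.neg hin' (neg_nonneg.2 ht)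

namespace IsAdmissibleFlow

variable {W : ℂ → ℂ} {Ψ : ℝ → ℂ → ℂ} {s : ℝ} {H : ℂ → ℝ}

theorem init (hΨ : IsAdmissibleFlow W Ψ) (z : ℂ) : Ψ 0 z = z := hΨ.isGlobalFlow.init z

theorem hasDerivAt (hΨ : IsAdmissibleFlow W Ψ) (t : ℝ) {z : ℂ} (hz : z ∈ closedDisc) :
    HasDerivAt (fun r => Ψ r z) (W (Ψ t z)) t :=
  hΨ.isGlobalFlow.hasDerivAt_of_mem (hΨ.mem t z hz)

theorem streamFunction_eq (hΨ : IsAdmissibleFlow W Ψ) (hH : IsStreamFunction W s H) (t : ℝ)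
    {z : ℂ} (hz : z ∈ closedDisc) : H (Ψ t z) = H z := by
  have hd : ∀ t, HasDerivAt (fun r => H (Ψ r z)) 0 t := fun t => by
    have h := hH.comp_hasDerivWithinAt (S := Set.univ) (hΨ.hasDerivAt t hz).hasDerivWithinAt
      (fun r _ => hΨ.mem r z hz) trivial
    rw [hasDerivWithinAt_univ] at h
    refine h.congr_deriv ?_
    rw [streamForm_apply]
    ring
  have := is_const_of_deriv_eq_zero (fun t => (hd t).differentiableAt) (fun t => (hd t).deriv) t 0
  simpa [hΨ.init] using this

/-- A `C¹` curve inside a level set is a reparametrisation of a trajectory. -/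
theorem exists_time_of_levelSet_curve (hΨ : IsAdmissibleFlow W Ψ) (hW : IsAdmissibleField W)
    (hH : IsStreamFunction W s H) {c : ℝ} (hc : c < H 0) {σ : ℝ → ℂ} (hσ : ContDiff ℝ 1 σ)
    (hσc : ∀ θ, σ θ ∈ closedDisc ∧ H (σ θ) = c) (b : ℝ) :
    ∃ B, ∀ θ ∈ Set.Icc 0 b, ∃ t, |t| ≤ B ∧ Ψ t (σ 0) = σ θ := by
  have hW0 : ∀ θ, W (σ θ) ≠ 0 := fun θ h => by
    have := (hσc θ).2
    rw [(hW.zero_iff _ (hσc θ).1).1 h] at this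
    exact hc.ne' this
  have hσd : ∀ θ, HasDerivAt σ (deriv σ θ) θ := fun θ =>
    (hσ.differentiable one_ne_zero θ).hasDerivAt
  have hs0 : s ≠ 0 := fun h => by simpa [h] using hH.sq_eq_one
  have hpar : ∀ θ, streamForm (W (σ θ)) (deriv σ θ) = 0 := fun θ => by
    have h := hH.comp_hasDerivWithinAt (S := Set.univ) (hσd θ).hasDerivWithinAt
      (fun r _ => (hσc r).1) trivial
    rw [hasDerivWithinAt_univ] at h
    have h2 : HasDerivAt (fun r => H (σ r)) 0 θ := by
      simp only [(hσc _).2]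
      exact hasDerivAt_const θ c
    exact (mul_eq_zero.1 (h.unique h2)).resolve_left hs0
  have hWσ : Continuous fun θ => W (σ θ) :=
    hW.contDiffOn.continuousOn.comp_continuous hσ.continuous fun θ => (hσc θ).1
  -- The velocity of `σ` is parallel to `W`, and `l` is the factor, read off by orthogonal
  -- projection; its primitive `L` is the time change.
  set l : ℝ → ℝ := fun θ =>
    ((W (σ θ)).re * (deriv σ θ).re + (W (σ θ)).im * (deriv σ θ).im) / Complex.normSq (W (σ θ))
    with hl
  have hσ' : Continuous (deriv σ) := hσ.continuous_deriv le_rfl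
  have hlc : Continuous l := by
    refine Continuous.div ?_ (Complex.continuous_normSq.comp hWσ) fun θ =>
      (Complex.normSq_pos.2 (hW0 θ)).ne'
    exact ((Complex.continuous_re.comp hWσ).mul (Complex.continuous_re.comp hσ')).add
      ((Complex.continuous_im.comp hWσ).mul (Complex.continuous_im.comp hσ'))
  have hσl : ∀ θ, deriv σ θ = l θ • W (σ θ) := fun θ => by
    have h1 := hpar θ
    have h2 := (Complex.normSq_pos.2 (hW0 θ)).ne'
    rw [streamForm_apply] at h1
    simp only [hl]
    rw [Complex.normSq_apply] at h2 ⊢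
    apply Complex.ext
    · rw [Complex.smul_re, smul_eq_mul, div_mul_eq_mul_div, eq_div_iff h2]
      linear_combination (-(W (σ θ)).im) * h1
    · rw [Complex.smul_im, smul_eq_mul, div_mul_eq_mul_div, eq_div_iff h2]
      linear_combination ((W (σ θ)).re) * h1
  set L : ℝ → ℝ := fun θ => ∫ x in (0 : ℝ)..θ, l x with hL
  have hLd : ∀ θ, HasDerivAt L (l θ) θ := fun θ =>
    intervalIntegral.integral_hasDerivAt_right (hlc.intervalIntegrable _ _)
      (hlc.stronglyMeasurableAtFilter _ _) hlc.continuousAt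
  obtain ⟨K, hK⟩ := exists_lipschitzWith_comp_radialProj hW.contDiffOn
  obtain ⟨C, hC⟩ := isCompact_Icc.exists_bound_of_continuousOn (hlc.continuousOn (s := Set.Icc 0 b))
  -- Both curves solve `z' = l θ • W z` from the same point.
  have heq : Set.EqOn σ (fun θ => Ψ (L θ) (σ 0)) (Set.Icc 0 b) := by
    refine ODE_solution_unique_of_mem_Icc_right (v := fun θ z => l θ • (W ∘ radialProj) z)
      (s := fun _ => Set.univ) (K := C.toNNReal * K) (fun θ hθ => ?_) hσ.continuous.continuousOn
      (fun θ _ => ?_) (fun _ _ => trivial) (fun θ _ => ?_) (fun θ _ => ?_) (fun _ _ => trivial) ?_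
    · refine LipschitzOnWith.of_dist_le_mul fun x _ y _ => ?_
      rw [dist_smul₀, NNReal.coe_mul, mul_assoc]
      refine mul_le_mul ?_ (hK.dist_le_mul x y) dist_nonneg (by positivity)
      exact (hC θ ⟨hθ.1, hθ.2.le⟩).trans (Real.le_coe_toNNReal C)
    · show HasDerivWithinAt σ (l θ • W (radialProj (σ θ))) (Set.Ici θ) θ
      rw [radialProj_of_mem (hσc θ).1, ← hσl]
      exact (hσd θ).hasDerivWithinAt
    · exact ((hΨ.isGlobalFlow.deriv (L θ) (σ 0)).scomp θ
        (hLd θ)).continuousAt.continuousWithinAt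
    · exact ((hΨ.isGlobalFlow.deriv (L θ) (σ 0)).scomp θ (hLd θ)).hasDerivWithinAt
    · simp [hL, hΨ.init]
  obtain ⟨B, hB⟩ := isCompact_Icc.exists_bound_of_continuousOn (s := Set.Icc 0 b) (f := L)
    fun θ _ => (hLd θ).continuousAt.continuousWithinAt
  exact ⟨B, fun θ hθ => ⟨L θ, hB θ hθ, (heq hθ).symm⟩⟩

theorem exists_bounded_time (hΨ : IsAdmissibleFlow W Ψ) (hW : IsAdmissibleField W)
    (hH : IsStreamFunction W s H) {c : ℝ} (hc0 : 0 ≤ c) (hc : c < H 0) :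
    ∃ p ∈ closedDisc, H p = c ∧ ∃ B, ∀ z ∈ closedDisc, H z = c → ∃ t, |t| ≤ B ∧ Ψ t p = z := by
  obtain ⟨σ, hσ, hσc, hsurj⟩ := hH.exists_contDiff_levelSet_parametrization hW hc0 hc
  obtain ⟨B, hB⟩ := hΨ.exists_time_of_levelSet_curve hW hH hc hσ hσc (2 * Real.pi)
  refine ⟨σ 0, (hσc 0).1, (hσc 0).2, B, fun z hz hzc => ?_⟩
  obtain ⟨θ, hθ, rfl⟩ := hsurj z hz hzc
  exact hB θ hθ

theorem map_zero (hΨ : IsAdmissibleFlow W Ψ) (hH : IsStreamFunction W s H) (t : ℝ) :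
    Ψ t 0 = 0 := by
  by_contra h
  have := hH.lt_zero _ (hΨ.mem t 0 zero_mem_closedDisc) h
  rw [hΨ.streamFunction_eq hH t zero_mem_closedDisc] at this
  exact this.false

theorem mem_openDisc (hΨ : IsAdmissibleFlow W Ψ) (hH : IsStreamFunction W s H) {z : ℂ}
    (hz : z ∈ openDisc) (t : ℝ) : Ψ t z ∈ openDisc := by
  have hz' := openDisc_subset_closedDisc hz
  refine (mem_openDisc_or_norm_eq_one (hΨ.mem t z hz')).resolve_right fun h => ?_
  have := hH.eq_zero _ h
  rw [hΨ.streamFunction_eq hH t hz'] at this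
  exact (hH.pos z hz).ne' this

/-- The orbits are exactly the level sets of a stream function. -/
theorem flowOrbit_eq_levelSet (hΨ : IsAdmissibleFlow W Ψ) (hW : IsAdmissibleField W)
    (hH : IsStreamFunction W s H) {z : ℂ} (hz : z ∈ closedDisc) :
    flowOrbit Ψ z = {w | w ∈ closedDisc ∧ H w = H z} := by
  ext w
  constructor
  · rintro ⟨t, rfl⟩
    exact ⟨hΨ.mem t z hz, hΨ.streamFunction_eq hH t hz⟩
  · rintro ⟨hw, hwz⟩
    rcases eq_or_ne z 0 with rfl | hz0
    · have hw0 : w = 0 := by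
        by_contra h
        exact (hH.lt_zero w hw h).ne hwz
      exact ⟨0, by rw [hw0]; exact hΨ.init 0⟩
    · obtain ⟨p, hp, hpc, B, hB⟩ :=
        hΨ.exists_bounded_time hW hH (hH.nonneg hz) (hH.lt_zero z hz hz0)
      obtain ⟨t, -, ht⟩ := hB z hz rfl
      obtain ⟨r, -, hr⟩ := hB w hw hwz
      refine ⟨r - t, ?_⟩
      simp only
      rw [← ht, ← hΨ.map_add, sub_add_cancel, hr]

theorem exists_pos_period (hΨ : IsAdmissibleFlow W Ψ) (hW : IsAdmissibleField W)
    (hH : IsStreamFunction W s H) {z : ℂ} (hz : z ∈ closedDisc) (hz0 : z ≠ 0) :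
    ∃ T, 0 < T ∧ Ψ T z = z := by
  obtain ⟨p, hp, hpc, B, hB⟩ :=
    hΨ.exists_bounded_time hW hH (hH.nonneg hz) (hH.lt_zero z hz hz0)
  obtain ⟨t, ht, htz⟩ := hB z hz rfl
  -- The point at time `B + 1` is also visited at a time `r ≤ B`; the gap `B + 1 - r > 0` is a
  -- period.
  obtain ⟨r, hr, hrp⟩ := hB (Ψ (B + 1) p) (hΨ.mem _ p hp)
    ((hΨ.streamFunction_eq hH _ hp).trans hpc)
  refine ⟨B + 1 - r, by linarith [(abs_le.1 hr).2], ?_⟩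
  have h1 : Ψ (B + 1 - r) p = p := by
    have h2 : Ψ (-r) (Ψ r p) = Ψ (-r) (Ψ (B + 1) p) := by rw [hrp]
    rw [← hΨ.map_add, ← hΨ.map_add, neg_add_cancel, hΨ.init] at h2
    rw [sub_eq_neg_add]
    exact h2.symm
  rw [← htz, ← hΨ.map_add, add_comm, hΨ.map_add, h1]

theorem exists_minimal_period (hΨ : IsAdmissibleFlow W Ψ) (hW : IsAdmissibleField W)
    (hH : IsStreamFunction W s H) {z : ℂ} (hz : z ∈ closedDisc) (hz0 : z ≠ 0) :
    ∃ T : ℝ, 0 < T ∧ Function.Periodic (fun t => Ψ t z) T ∧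
      Set.InjOn (fun t => Ψ t z) (Set.Ico 0 T) := by
  have hWz : W z ≠ 0 := fun h => hz0 ((hW.zero_iff z hz).1 h)
  have hd : HasDerivAt (fun r => Ψ r z) (W z) 0 := by
    have := hΨ.hasDerivAt 0 hz
    rwa [hΨ.init] at this
  -- Since `W z ≠ 0`, there is no return before some time `ε`. The positive return times thus form a
  -- closed set bounded below by `ε`, whose infimum is attained.
  obtain ⟨ε, hε, hne⟩ : ∃ ε > 0, ∀ t, 0 < t → t < ε → Ψ t z ≠ z := by
    have h := hd.eventually_ne hWz (c := z)
    rw [eventually_nhdsWithin_iff, Metric.eventually_nhds_iff] at h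
    obtain ⟨ε, hε, h⟩ := h
    exact ⟨ε, hε, fun t ht htε => h (by rwa [Real.dist_0_eq_abs, abs_of_pos ht]) ht.ne'⟩
  have hcont : Continuous fun t => Ψ t z :=
    continuous_iff_continuousAt.2 fun t => (hΨ.hasDerivAt t hz).continuousAt
  set P : Set ℝ := {t | ε ≤ t ∧ Ψ t z = z} with hP
  have hPc : IsClosed P := isClosed_Ici.inter (isClosed_eq hcont continuous_const)
  have hPpos : ∀ t, 0 < t → Ψ t z = z → t ∈ P := fun t ht htz =>
    ⟨not_lt.1 fun h => hne t ht h htz, htz⟩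
  obtain ⟨T₀, hT₀, hT₀z⟩ := hΨ.exists_pos_period hW hH hz hz0
  have hPb : BddBelow P := ⟨ε, fun t ht => ht.1⟩
  have hTP : sInf P ∈ P := hPc.csInf_mem ⟨T₀, hPpos _ hT₀ hT₀z⟩ hPb
  refine ⟨sInf P, hε.trans_le hTP.1, fun t => ?_, ?_⟩
  · simp only
    rw [hΨ.map_add, hTP.2]
  · have key : ∀ a b, 0 ≤ a → a < b → b < sInf P → Ψ a z ≠ Ψ b z := by
      intro a b ha hab hb h
      have h2 : Ψ (-a) (Ψ a z) = Ψ (-a) (Ψ b z) := by rw [h]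
      rw [← hΨ.map_add, ← hΨ.map_add, neg_add_cancel, hΨ.init] at h2
      have := csInf_le hPb (hPpos (-a + b) (by linarith) h2.symm)
      linarith
    intro a ha b hb hab
    rcases lt_trichotomy a b with h | h | h
    · exact absurd hab (key a b ha.1 h hb.2)
    · exact h
    · exact absurd hab.symm (key b a hb.1 h ha.2)

end IsAdmissibleFlow

end Orbits

/-! ### Superlevel sets as the enclosed simply connected domains -/

section SuperlevelSets

variable {W : ℂ → ℂ} {s m : ℝ} {H : ℂ → ℝ}

namespace IsStreamFunction

theorem superlevelSet_subset_openDisc (hH : IsStreamFunction W s H) {c : ℝ} (hc0 : 0 ≤ c) :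
    {z | z ∈ closedDisc ∧ c < H z} ⊆ openDisc := by
  rintro z ⟨hz, hcz⟩
  refine (mem_openDisc_or_norm_eq_one hz).resolve_right fun h => ?_
  rw [hH.eq_zero z h] at hcz
  linarith

theorem isOpen_superlevelSet (hH : IsStreamFunction W s H) {c : ℝ} (hc0 : 0 ≤ c) :
    IsOpen {z | z ∈ closedDisc ∧ c < H z} := by
  have h : {z | z ∈ closedDisc ∧ c < H z} = openDisc ∩ H ⁻¹' Set.Ioi c := by
    ext z
    exact ⟨fun hz => ⟨hH.superlevelSet_subset_openDisc hc0 hz, hz.2⟩,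
      fun hz => ⟨openDisc_subset_closedDisc hz.1, hz.2⟩⟩
  rw [h]
  exact (hH.continuousOn.mono openDisc_subset_closedDisc).isOpen_inter_preimage isOpen_openDisc
    isOpen_Ioi

theorem frontier_superlevelSet (hH : IsStreamFunction W s H) (hW : IsAdmissibleField W) {c : ℝ}
    (hc0 : 0 ≤ c) (hc : c < H 0) :
    frontier {z | z ∈ closedDisc ∧ c < H z} = {z | z ∈ closedDisc ∧ H z = c} := by
  rw [(hH.isOpen_superlevelSet hc0).frontier_eq]
  ext z
  constructor
  · rintro ⟨hz, hz'⟩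
    have hcl : IsClosed (closedDisc ∩ H ⁻¹' Set.Ici c) :=
      hH.continuousOn.preimage_isClosed_of_isClosed isCompact_closedDisc.isClosed isClosed_Ici
    have hsub : {z | z ∈ closedDisc ∧ c < H z} ⊆ closedDisc ∩ H ⁻¹' Set.Ici c := fun w hw =>
      ⟨hw.1, hw.2.le⟩
    have h := closure_minimal hsub hcl hz
    exact ⟨h.1, le_antisymm (not_lt.1 fun hlt => hz' ⟨h.1, hlt⟩) h.2⟩
  · rintro ⟨hz, hzc⟩
    refine ⟨?_, fun h => h.2.ne' hzc⟩
    -- The room between `c` and `c'` lets the ascent flow raise `H` strictly above `c` for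
    -- arbitrarily short times, so `z` is a limit of points of the superlevel set.
    obtain ⟨c', hcc', hc'⟩ := exists_between hc
    obtain ⟨m, hm, hmc⟩ := hH.exists_normSq_lower_bound hW hc'
    obtain ⟨Φ, hΦ⟩ := exists_isGlobalFlow_comp_radialProj
      (contDiffOn_ascentField (s := s) hW.contDiffOn hm)
    have hlim : Filter.Tendsto (fun t => Φ t z) (nhdsWithin 0 (Set.Ioi 0)) (nhds z) := by
      have := (hΦ.deriv 0 z).continuousAt.tendsto
      rw [hΦ.init] at this
      exact this.mono_left nhdsWithin_le_nhds
    refine mem_closure_of_tendsto hlim ?_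
    filter_upwards [Ioo_mem_nhdsGT (sub_pos.2 hcc')] with t ht
    refine ⟨hΦ.mem_closedDisc_of_inward (hH.ascentField_inward hm) ht.1.le hz, ?_⟩
    have := hH.eq_time_of_ascentFlow hm hmc hΦ hz ht.1.le (by linarith [ht.2])
    linarith [ht.1]

theorem ascentFlow_monotone (hH : IsStreamFunction W s H) (hm : 0 < m) {Φ : ℝ → ℂ → ℂ}
    (hΦ : IsGlobalFlow (ascentField W s m ∘ radialProj) Φ) {z : ℂ} (hz : z ∈ closedDisc)
    {a b : ℝ} (ha : 0 ≤ a) (hab : a ≤ b) : H (Φ a z) ≤ H (Φ b z) := by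
  have hmem : ∀ r, 0 ≤ r → Φ r z ∈ closedDisc := fun r hr =>
    hΦ.mem_closedDisc_of_inward (hH.ascentField_inward hm) hr hz
  exact hH.le_of_ascent (y := fun r => Φ r z) hm hab (fun r hr => hmem r (ha.trans hr.1))
    fun r hr => hΦ.hasDerivAt_of_mem (hmem r (ha.trans hr.1))

/-- Points with `H > c` lie within `r` of the origin for some `c < H 0`, and on the compact set `H ≤
c` the growth rate has a positive minimum, so every trajectory leaves that set by a common time. -/
theorem ascentFlow_tendsto_uniformly (hH : IsStreamFunction W s H) (hW : IsAdmissibleField W)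
    (hm : 0 < m) {Φ : ℝ → ℂ → ℂ} (hΦ : IsGlobalFlow (ascentField W s m ∘ radialProj) Φ)
    {r : ℝ} (hr : 0 < r) : ∃ T, 0 < T ∧ ∀ t, T ≤ t → ∀ z ∈ closedDisc, ‖Φ t z‖ < r := by
  have hmem : ∀ t, 0 ≤ t → ∀ z ∈ closedDisc, Φ t z ∈ closedDisc := fun t ht z hz =>
    hΦ.mem_closedDisc_of_inward (hH.ascentField_inward hm) ht hz
  obtain ⟨c, hc, hcr⟩ : ∃ c < H 0, ∀ z ∈ closedDisc, c < H z → ‖z‖ < r := by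
    have hA : IsCompact (closedDisc ∩ {z | r ≤ ‖z‖}) :=
      isCompact_closedDisc.inter_right (isClosed_le continuous_const continuous_norm)
    rcases (closedDisc ∩ {z | r ≤ ‖z‖}).eq_empty_or_nonempty with he | hne
    · refine ⟨H 0 - 1, by linarith, fun z hz _ => ?_⟩
      by_contra! h
      have : z ∈ closedDisc ∩ {z | r ≤ ‖z‖} := ⟨hz, h⟩
      rw [he] at this
      exact this
    · obtain ⟨w, hw, hmax⟩ := hA.exists_isMaxOn hne (hH.continuousOn.mono Set.inter_subset_left)
      have hw2 : r ≤ ‖w‖ := hw.2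
      refine ⟨H w, hH.lt_zero w hw.1 (norm_pos_iff.1 (hr.trans_le hw2)), fun z hz hwz => ?_⟩
      by_contra! h
      exact absurd (hmax ⟨hz, h⟩ : H z ≤ H w) (not_le.2 hwz)
  obtain ⟨κ, hκ, hκc⟩ : ∃ κ > 0, ∀ z ∈ closedDisc, H z ≤ c → κ ≤ ascentRate W m z := by
    have hB : IsCompact (closedDisc ∩ H ⁻¹' Set.Iic c) :=
      isCompact_closedDisc.of_isClosed_subset
        (hH.continuousOn.preimage_isClosed_of_isClosed isCompact_closedDisc.isClosed isClosed_Iic)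
        Set.inter_subset_left
    rcases (closedDisc ∩ H ⁻¹' Set.Iic c).eq_empty_or_nonempty with he | hne
    · refine ⟨1, one_pos, fun z hz h => ?_⟩
      have : z ∈ closedDisc ∩ H ⁻¹' Set.Iic c := ⟨hz, h⟩
      rw [he] at this
      exact this.elim
    · obtain ⟨w, hw, hmin⟩ := hB.exists_isMinOn hne
        ((continuousOn_ascentRate hW.contDiffOn.continuousOn hm).mono Set.inter_subset_left)
      refine ⟨_, ascentRate_pos hm fun h => ?_, fun z hz h => hmin ⟨hz, h⟩⟩
      have h1 : H w ≤ c := hw.2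
      rw [(hW.zero_iff w hw.1).1 h] at h1
      linarith
  -- Staying at `H ≤ c` for this time would raise `H` by at least `|c| + 1 > c`, starting from a
  -- nonnegative value.
  refine ⟨(|c| + 1) / κ, by positivity, fun t ht z hz => ?_⟩
  have ht0 : 0 ≤ t := le_trans (by positivity) ht
  refine hcr _ (hmem t ht0 z hz) ?_
  by_contra! hle
  have h := hH.add_mul_le_of_ascent (y := fun q => Φ q z) (a := 0) (b := t) (κ := κ) ht0
    (fun q hq => hmem q hq.1 z hz) (fun q hq => hΦ.hasDerivAt_of_mem (hmem q hq.1 z hz))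
    (fun q hq => hκc _ (hmem q hq.1 z hz)
      ((hH.ascentFlow_monotone hm hΦ hz hq.1 hq.2).trans hle))
  rw [div_le_iff₀ hκ] at ht
  simp only [hΦ.init, sub_zero] at h
  linarith [hH.nonneg hz, le_abs_self c]

/-- The superlevel sets of a stream function are contracted to the origin by the ascent flow. -/
theorem contractibleSpace_superlevelSet (hH : IsStreamFunction W s H) (hW : IsAdmissibleField W)
    {c : ℝ} (hc : c < H 0) : ContractibleSpace {z | z ∈ closedDisc ∧ c < H z} := by
  -- Only monotonicity of `H` and convergence to the origin are used here, so any positive `m`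
  -- serves.
  have hV := contDiffOn_ascentField (s := s) hW.contDiffOn one_pos
  obtain ⟨Φ, hΦ⟩ := exists_isGlobalFlow_comp_radialProj hV
  obtain ⟨K, hK⟩ := exists_lipschitzWith_comp_radialProj hV
  have hΦc := hΦ.continuous_uncurry hK
  have hmem : ∀ t, 0 ≤ t → ∀ z ∈ {z | z ∈ closedDisc ∧ c < H z},
      Φ t z ∈ {z | z ∈ closedDisc ∧ c < H z} := fun t ht z hz => by
    refine ⟨hΦ.mem_closedDisc_of_inward (hH.ascentField_inward one_pos) ht hz.1, ?_⟩
    have := hH.ascentFlow_monotone one_pos hΦ hz.1 le_rfl ht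
    rw [hΦ.init] at this
    exact hz.2.trans_le this
  have h0 : (0 : ℂ) ∈ {z | z ∈ closedDisc ∧ c < H z} := ⟨zero_mem_closedDisc, hc⟩
  -- The flow over `[0, ∞)` is compressed to `[0, 1)` by `t / (1 - t)`; continuity at the end time
  -- is the uniform convergence to `0`.
  set F : unitInterval × {z | z ∈ closedDisc ∧ c < H z} → ℂ := fun p =>
    if (p.1 : ℝ) < 1 then Φ (p.1 / (1 - p.1)) p.2 else 0 with hF
  have hFmem : ∀ p, F p ∈ {z | z ∈ closedDisc ∧ c < H z} := fun p => by
    simp only [hF]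
    split_ifs with h
    · exact hmem _ (div_nonneg p.1.2.1 (by linarith)) _ p.2.2
    · exact h0
  have hFc : Continuous F := by
    rw [continuous_iff_continuousAt]
    intro p
    by_cases hp : (p.1 : ℝ) < 1
    · have h1 : ContinuousAt (fun q : unitInterval × {z | z ∈ closedDisc ∧ c < H z} =>
          Φ (q.1 / (1 - q.1)) q.2) p := by
        refine ContinuousAt.comp (f := fun q : unitInterval × {z | z ∈ closedDisc ∧ c < H z} =>
          ((q.1 / (1 - q.1) : ℝ), (q.2 : ℂ))) (g := fun q : ℝ × ℂ => Φ q.1 q.2)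
          hΦc.continuousAt (ContinuousAt.prodMk (ContinuousAt.div ?_ ?_ (by linarith)) ?_)
        · fun_prop
        · fun_prop
        · fun_prop
      refine h1.congr ?_
      have hopen : IsOpen {q : unitInterval × {z | z ∈ closedDisc ∧ c < H z} | (q.1 : ℝ) < 1} :=
        isOpen_lt (by fun_prop) continuous_const
      filter_upwards [hopen.mem_nhds hp] with q hq
      have hq' : (q.1 : ℝ) < 1 := hq
      simp only [hF, if_pos hq']
    · have hp1 : (p.1 : ℝ) = 1 := le_antisymm p.1.2.2 (not_lt.1 hp)
      have hFp : F p = 0 := by simp only [hF, if_neg hp]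
      rw [ContinuousAt, hFp, Metric.tendsto_nhds]
      intro r hr
      obtain ⟨T, hT, hTr⟩ := hH.ascentFlow_tendsto_uniformly hW one_pos hΦ hr
      have hopen : IsOpen {q : unitInterval × {z | z ∈ closedDisc ∧ c < H z} |
          T / (1 + T) < (q.1 : ℝ)} := isOpen_lt continuous_const (by fun_prop)
      have hpT : T / (1 + T) < (p.1 : ℝ) := by
        rw [hp1, div_lt_one (by linarith)]
        linarith
      filter_upwards [hopen.mem_nhds hpT] with q hq
      have hq' : T / (1 + T) < (q.1 : ℝ) := hq
      rw [dist_zero_right]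
      simp only [hF]
      split_ifs with h
      · refine hTr _ ?_ _ q.2.2.1
        rw [div_lt_iff₀ (by linarith)] at hq'
        rw [le_div_iff₀ (by linarith)]
        linarith
      · simpa using hr
  refine (contractible_iff_id_nullhomotopic _).2 ⟨⟨0, h0⟩, ⟨?_⟩⟩
  exact
    { toFun := fun p => ⟨F p, hFmem p⟩
      continuous_toFun := hFc.subtype_mk hFmem
      map_zero_left := fun z => by
        apply Subtype.ext
        simp [hF, hΦ.init]
      map_one_left := fun z => by
        apply Subtype.ext
        simp [hF] }

theorem isSimplyConnectedDomainEnclosedBy_superlevelSet (hH : IsStreamFunction W s H)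
    (hW : IsAdmissibleField W) {c : ℝ} (hc0 : 0 ≤ c) (hc : c < H 0) :
    IsSimplyConnectedDomainEnclosedBy {z | z ∈ closedDisc ∧ c < H z}
      {z | z ∈ closedDisc ∧ H z = c} where
  isOpen := hH.isOpen_superlevelSet hc0
  isBounded := isCompact_closedDisc.isBounded.subset fun _ hz => hz.1
  simplyConnected := by
    have := hH.contractibleSpace_superlevelSet hW hc
    exact SimplyConnectedSpace.ofContractible _
  frontier_eq := hH.frontier_superlevelSet hW hc0 hc

end IsStreamFunction

end SuperlevelSets

/-! ### Reflection and rotation symmetries -/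

section Symmetries

theorem conj_mem_closedDisc {z : ℂ} (hz : z ∈ closedDisc) : (starRingEnd ℂ) z ∈ closedDisc := by
  rw [mem_closedDisc, RCLike.norm_conj]
  exact mem_closedDisc.1 hz

theorem rotation_mem_closedDisc (θ : ℝ) {z : ℂ} (hz : z ∈ closedDisc) :
    Complex.exp (θ * Complex.I) * z ∈ closedDisc := by
  rw [mem_closedDisc, norm_mul, Complex.norm_exp_ofReal_mul_I, one_mul]
  exact mem_closedDisc.1 hz

namespace IsStreamFunction

variable {W : ℂ → ℂ} {s : ℝ} {H : ℂ → ℝ}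

/-- A linear isometry which preserves the form `dH` preserves `H`. -/
theorem comp_eq_of_streamForm (hH : IsStreamFunction W s H) (A : ℂ →L[ℝ] ℂ)
    (hA : ∀ z, ‖A z‖ = ‖z‖)
    (hWA : ∀ z ∈ closedDisc, ∀ v, streamForm (W (A z)) (A v) = streamForm (W z) v) {z : ℂ}
    (hz : z ∈ closedDisc) : H (A z) = H z := by
  have hmaps : Set.MapsTo A closedDisc closedDisc := fun w hw => by
    rw [mem_closedDisc, hA]
    exact mem_closedDisc.1 hw
  have hd : ∀ w ∈ closedDisc, HasFDerivWithinAt (fun w => H (A w) - H w) (0 : ℂ →L[ℝ] ℝ)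
      closedDisc w := by
    intro w hw
    have h1 := (hH.hasFDerivWithinAt (A w) (hmaps hw)).comp w A.hasFDerivWithinAt hmaps
    refine (h1.sub (hH.hasFDerivWithinAt w hw)).congr_fderiv ?_
    refine ContinuousLinearMap.ext fun v => ?_
    simp [hWA w hw, -streamForm_apply]
  have h1 : (1 : ℂ) ∈ closedDisc := by simp [mem_closedDisc]
  have h := convex_closedDisc.is_const_of_fderivWithin_eq_zero (𝕜 := ℝ)
    (f := fun w => H (A w) - H w) (fun w hw => (hd w hw).differentiableWithinAt)
    (fun w hw => (hd w hw).fderivWithin (uniqueDiffOn_closedDisc w hw)) hz h1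
  -- The constant difference is evaluated at `1`: both `1` and `A 1` lie on the unit circle, where
  -- `H` vanishes.
  rw [hH.eq_zero (A 1) (by rw [hA]; simp), hH.eq_zero 1 (by simp), sub_self] at h
  exact sub_eq_zero.1 h

/-- Conjugation reverses the sign of the determinant, and the minus sign in the hypothesis on `W`
compensates. -/
theorem comp_conj (hH : IsStreamFunction W s H)
    (hW : ∀ z ∈ closedDisc, (starRingEnd ℂ) (W z) = -W ((starRingEnd ℂ) z)) {z : ℂ}
    (hz : z ∈ closedDisc) : H ((starRingEnd ℂ) z) = H z := by
  refine hH.comp_eq_of_streamForm (Complex.conjCLE : ℂ →L[ℝ] ℂ) (fun z => RCLike.norm_conj z)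
    (fun w hw v => ?_) hz
  have h : W ((starRingEnd ℂ) w) = -(starRingEnd ℂ) (W w) := by rw [hW w hw, neg_neg]
  show streamForm (W ((starRingEnd ℂ) w)) ((starRingEnd ℂ) v) = _
  rw [h]
  simp
  ring

theorem comp_rotation (hH : IsStreamFunction W s H) {θ : ℝ}
    (hW : ∀ z ∈ closedDisc,
      W (Complex.exp (θ * Complex.I) * z) = Complex.exp (θ * Complex.I) * W z) {z : ℂ}
    (hz : z ∈ closedDisc) : H (Complex.exp (θ * Complex.I) * z) = H z := by
  refine hH.comp_eq_of_streamForm (ContinuousLinearMap.mul ℝ ℂ (Complex.exp (θ * Complex.I)))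
    (fun w => ?_) (fun w hw v => ?_) hz
  · simp [Complex.norm_exp_ofReal_mul_I]
  · have h1 : Complex.normSq (Complex.exp (θ * Complex.I)) = 1 := by
      rw [Complex.normSq_eq_norm_sq, Complex.norm_exp_ofReal_mul_I, one_pow]
    rw [Complex.normSq_apply] at h1
    simp only [ContinuousLinearMap.mul_apply', hW w hw, streamForm_apply, Complex.mul_re,
      Complex.mul_im]
    linear_combination ((W w).re * v.im - (W w).im * v.re) * h1

end IsStreamFunction

end Symmetries

/-! ### Uniqueness of trajectories in the closed disc -/

section Uniqueness

/-- A trajectory of an admissible field in the closed disc is given by the flow. -/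
theorem IsAdmissibleFlow.eqOn_of_isDiscTrajectoryOn {W : ℂ → ℂ} {Ψ : ℝ → ℂ → ℂ}
    (hΨ : IsAdmissibleFlow W Ψ) (hW : IsAdmissibleField W) {S : Set ℝ} {γ : ℝ → ℂ}
    (hS : S.OrdConnected) (h0 : (0 : ℝ) ∈ S) (hγ : IsDiscTrajectoryOn W γ S) :
    Set.EqOn γ (fun t => Ψ t (γ 0)) S := by
  obtain ⟨K, hK⟩ := exists_lipschitzOnWith_closedDisc hW.contDiffOn
  have hz := hγ.1 h0
  have hd : ∀ t, HasDerivAt (fun r => Ψ r (γ 0)) (W (Ψ t (γ 0))) t := fun t =>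
    hΨ.hasDerivAt t hz
  intro t ht
  rcases le_total 0 t with h | h
  · have hsub : Set.Icc 0 t ⊆ S := hS.out h0 ht
    refine ODE_solution_unique_of_mem_Icc_right (v := fun _ => W) (s := fun _ => closedDisc)
      (K := K) (fun _ _ => hK) (fun r hr => (hγ.2 r (hsub hr)).continuousWithinAt.mono hsub)
      (fun r hr => ?_) (fun r hr => hγ.1 (hsub ⟨hr.1, hr.2.le⟩))
      (fun r _ => (hd r).continuousAt.continuousWithinAt) (fun r _ => (hd r).hasDerivWithinAt)
      (fun r _ => hΨ.mem r _ hz) (hΨ.init _).symm ⟨h, le_rfl⟩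
    exact ((hγ.2 r (hsub ⟨hr.1, hr.2.le⟩)).mono hsub).mono_of_mem_nhdsWithin
      (Icc_mem_nhdsGE_of_mem hr)
  · have hsub : Set.Icc t 0 ⊆ S := hS.out ht h0
    refine ODE_solution_unique_of_mem_Icc_left (v := fun _ => W) (s := fun _ => closedDisc)
      (K := K) (fun _ _ => hK) (fun r hr => (hγ.2 r (hsub hr)).continuousWithinAt.mono hsub)
      (fun r hr => ?_) (fun r hr => hγ.1 (hsub ⟨hr.1.le, hr.2⟩))
      (fun r _ => (hd r).continuousAt.continuousWithinAt) (fun r _ => (hd r).hasDerivWithinAt)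
      (fun r _ => hΨ.mem r _ hz) (hΨ.init _).symm ⟨le_rfl, h⟩
    exact ((hγ.2 r (hsub ⟨hr.1.le, hr.2⟩)).mono hsub).mono_of_mem_nhdsWithin
      (Icc_mem_nhdsLE_of_mem hr)

end Uniqueness

theorem proposition7p3 (W : ℂ → ℂ) (hW : IsAdmissibleField W) :
    ∃ ψ : ℝ → ℂ → ℂ,
      -- `ψ` is a global flow, and every trajectory, on whatever time interval, is given by it
      IsDiscFlow W ψ ∧
      (∀ (S : Set ℝ) (γ : ℝ → ℂ), S.OrdConnected → (0 : ℝ) ∈ S → IsDiscTrajectoryOn W γ S →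
        Set.EqOn γ (fun t => ψ t (γ 0)) S) ∧
      -- all trajectories are periodic orbits inside the disc enclosing a simply connected
      -- domain that contains the origin
      (∀ t : ℝ, ψ t 0 = 0) ∧
      (∀ z ∈ openDisc, ∀ t : ℝ, ψ t z ∈ openDisc) ∧
      (∀ z ∈ closedDisc, z ≠ 0 →
        (∃ T : ℝ, 0 < T ∧ Function.Periodic (fun t => ψ t z) T ∧
          Set.InjOn (fun t => ψ t z) (Set.Ico 0 T)) ∧
        ∃ Ω : Set ℂ, IsSimplyConnectedDomainEnclosedBy Ω (flowOrbit ψ z) ∧ (0 : ℂ) ∈ Ω) ∧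
      -- the flow is a group of diffeomorphisms of the closed disc
      (∀ t : ℝ, IsClosedDiscDiffeo (ψ t)) ∧
      (∀ s t : ℝ, ∀ z ∈ closedDisc, ψ (s + t) z = ψ s (ψ t z)) ∧
      -- reflection symmetry
      ((∀ z ∈ closedDisc, (starRingEnd ℂ) (W z) = -W ((starRingEnd ℂ) z)) →
        ∀ z ∈ closedDisc, (starRingEnd ℂ) '' flowOrbit ψ z = flowOrbit ψ z) ∧
      -- rotation symmetry
      (∀ θ₀ : ℝ,
        (∀ z ∈ closedDisc,
          W (Complex.exp (θ₀ * Complex.I) * z) = Complex.exp (θ₀ * Complex.I) * W z) →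
        ∀ z ∈ closedDisc,
          (fun w => Complex.exp (θ₀ * Complex.I) * w) '' flowOrbit ψ z = flowOrbit ψ z) := by
  obtain ⟨Ψ, hΨ⟩ := hW.exists_isAdmissibleFlow
  obtain ⟨s, H, hH⟩ := hW.exists_isStreamFunction
  have hinv : ∀ t z, Ψ (-t) (Ψ t z) = z := fun t z => by
    rw [← hΨ.map_add, neg_add_cancel, hΨ.init]
  have hinv' : ∀ t z, Ψ t (Ψ (-t) z) = z := fun t z => by
    rw [← hΨ.map_add, add_neg_cancel, hΨ.init]
  refine ⟨Ψ, ⟨fun z _ => hΨ.init z, hΨ.mem, fun t z hz => hΨ.hasDerivAt t hz⟩,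
    fun S γ hS h0 hγ => hΨ.eqOn_of_isDiscTrajectoryOn hW hS h0 hγ, hΨ.map_zero hH,
    fun z hz t => hΨ.mem_openDisc hH hz t, fun z hz hz0 => ⟨hΨ.exists_minimal_period hW hH hz hz0,
      {w | w ∈ closedDisc ∧ H z < H w}, ?_, zero_mem_closedDisc, hH.lt_zero z hz hz0⟩,
    fun t => ⟨⟨hΨ.mem t, fun z _ w _ h => ?_, fun z hz => ⟨Ψ (-t) z, hΨ.mem _ z hz, hinv' t z⟩⟩,
      hΨ.contDiffOn t, Ψ (-t), hΨ.mem _, ⟨fun z _ => hinv t z, fun z _ => hinv' t z⟩,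
      hΨ.contDiffOn _⟩,
    fun s t z _ => hΨ.map_add s t z, fun hsymm z hz => ?_, fun θ hsymm z hz => ?_⟩
  · rw [hΨ.flowOrbit_eq_levelSet hW hH hz]
    exact hH.isSimplyConnectedDomainEnclosedBy_superlevelSet hW (hH.nonneg hz)
      (hH.lt_zero z hz hz0)
  · rw [← hinv t z, ← hinv t w]
    exact congrArg (Ψ (-t)) h
  · rw [hΨ.flowOrbit_eq_levelSet hW hH hz]
    refine Set.Subset.antisymm ?_ fun w hw =>
      ⟨(starRingEnd ℂ) w, ⟨conj_mem_closedDisc hw.1, ?_⟩, Complex.conj_conj w⟩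
    · rintro _ ⟨w, hw, rfl⟩
      exact ⟨conj_mem_closedDisc hw.1, (hH.comp_conj hsymm hw.1).trans hw.2⟩
    · exact (hH.comp_conj hsymm hw.1).trans hw.2
  · rw [hΨ.flowOrbit_eq_levelSet hW hH hz]
    refine Set.Subset.antisymm ?_ fun w hw => ?_
    · rintro _ ⟨w, hw, rfl⟩
      exact ⟨rotation_mem_closedDisc θ hw.1, (hH.comp_rotation hsymm hw.1).trans hw.2⟩
    · have hback : Complex.exp (θ * Complex.I) * (Complex.exp ((-θ : ℝ) * Complex.I) * w) = w := by
        rw [← mul_assoc, ← Complex.exp_add, Complex.ofReal_neg, neg_mul, add_neg_cancel,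
          Complex.exp_zero, one_mul]
      have hw' := rotation_mem_closedDisc (-θ) hw.1
      refine ⟨Complex.exp ((-θ : ℝ) * Complex.I) * w, ⟨hw', ?_⟩, hback⟩
      rw [← hH.comp_rotation hsymm hw', hback]
      exact hw.2
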